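/- Let $A$ be a unital involutive Banach algebra (with isometric involution) such that $K_0(A)$ is generated by the classes of self-adjoint projections $p=p^2=p^*\in M_N(A)$, $N\ge 0$ (for instance, a unital $C^*$-algebra), and let $(\sigma_t)_{t\in\mathbb R}$ be a strongly continuous one-parameter group of isometric automorphisms of $A$. Let $\mathcal O\subset A$ be a dense unital $*$-subalgebra which, together with its matrix algebras, is stable under holomorphic functional calculus in $A$, and let $\sigma$ be an automorphism of $\mathcal O$. Assume (1PG): for every $a\in\mathcal O$ the map $t\mapsto\sigma_t(a)$ extends to an entire function $\mathbb C\to A$, whose value at $t=-i$ is $\sigma(a)$. Let $(\mathcal O,\mathfrak H,D)$ be a graded $\sigma$-spectral triple with $D$ invertible: $\mathcal O$ is represented (unitally and involutively) on the Hilbert space $\mathfrak H$; $D$ is a self-adjoint operator with compact resolvent and bounded inverse; every $a\in\mathcal O$ preserves $\mathrm{Dom}\,D$, and $Da-\sigma(a)D$ is bounded; $\sigma(a^*)=(\sigma^{-1}(a))^*$ for all $a\in\mathcal O$; and there is a grading $\gamma=\gamma^*$, $\gamma^2=1$, which commutes with $\mathcal O$, preserves $\mathrm{Dom}\,D$ and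 satisfies $D\gamma=-\gamma D$. Write $\mathfrak H=\mathfrak H_+\oplus\mathfrak H_-$, $a=a_+\oplus a_-$ and $D_\pm:\mathfrak H_\pm\to\mathfrak H_\mp$ for the decompositions with respect to $\gamma$. For an idempotent $e\in M_N(\mathcal O)$ let $f_\pm$ be the bounded closure of $D_\pm^{-1}\sigma(e_\mp)D_\pm$ on $\mathfrak H_\pm^N$. Then, for each sign, the operators $f_\pm e_\pm:e_\pm\mathfrak H_\pm^N\to f_\pm\mathfrak H_\pm^N$ are Fredholm, and there is a unique group homomorphism $\mathrm{Index}^\pm_{D,\sigma}:K_0(A)\to\mathbb Z$ with $$\mathrm{Index}^\pm_{D,\sigma}[e]=\mathrm{Index}(f_\pm e_\pm)\qquad\text{for all } N \text{ and all } e=e^2\in M_N(\mathcal O).$$ Moreover $$\mathrm{Index}^+_{D,\sigma}=-\,\mathrm{Index}^-_{D,\sigma}:K_0(A)\to\mathbb Z ,$$ so that the double index map $(\mathrm{Index}^+_{D,\sigma},\mathrm{Index}^-_{D,\sigma}):K_0(A)\to\mathbb Z\times\mathbb Z$ has the form $(J,-J)$ for a single homomorphism $J:K_0(A)\to\mathbb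 Z$. -/

import Mathlib

open Filter Topology

noncomputable section

/-! ### The algebraic `K₀`-group of a unital ring, by idempotent matrices -/

/-- Idempotent square matrices of arbitrary size over `R`. -/
structure IdemMatrix (R : Type*) [Ring R] where
  size : ℕ
  mat : Matrix (Fin size) (Fin size) R
  idem : mat * mat = mat

namespace IdemMatrix

variable {R : Type*} [Ring R]

/-- (Murray–von Neumann) equivalence of idempotents: `e = x y` and `f = y x` for some rectangular
matrices `x`, `y`. -/
def Equivalent (e f : IdemMatrix R) : Prop :=
  ∃ (x : Matrix (Fin e.size) (Fin f.size) R) (y : Matrix (Fin f.size) (Fin e.size) R),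
    x * y = e.mat ∧ y * x = f.mat

/-- The block diagonal sum `e ⊕ f`. -/
def blockSum (e f : IdemMatrix R) : IdemMatrix R where
  size := e.size + f.size
  mat := (Matrix.fromBlocks e.mat 0 0 f.mat).submatrix finSumFinEquiv.symm finSumFinEquiv.symm
  idem := by
    rw [Matrix.submatrix_mul_equiv, Matrix.fromBlocks_multiply]
    simp [e.idem, f.idem]

end IdemMatrix

/-- The relations `[e] = [f]` for equivalent `e`, `f`, and `[e ⊕ f] = [e] + [f]`. -/
def K0Relations (R : Type*) [Ring R] : Set (FreeAbelianGroup (IdemMatrix R)) :=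
  {x | ∃ e f : IdemMatrix R, e.Equivalent f ∧
      x = FreeAbelianGroup.of e - FreeAbelianGroup.of f} ∪
  {x | ∃ e f : IdemMatrix R,
      x = FreeAbelianGroup.of (e.blockSum f) - (FreeAbelianGroup.of e + FreeAbelianGroup.of f)}

/-- `K₀(R)`: the Grothendieck group of the monoid of equivalence classes of idempotent matrices
over `R`, presented by generators and relations. -/
def K0 (R : Type*) [Ring R] : Type _ :=
  FreeAbelianGroup (IdemMatrix R) ⧸ AddSubgroup.closure (K0Relations R)

instance (R : Type*) [Ring R] : AddCommGroup (K0 R) :=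
  inferInstanceAs
    (AddCommGroup (FreeAbelianGroup (IdemMatrix R) ⧸ AddSubgroup.closure (K0Relations R)))

/-- The class `[e] ∈ K₀(R)` of an idempotent matrix. -/
def K0.cls {R : Type*} [Ring R] (e : IdemMatrix R) : K0 R :=
  QuotientAddGroup.mk (FreeAbelianGroup.of e)

/-- The image of an idempotent matrix under a ring homomorphism. -/
def IdemMatrix.map {R S : Type*} [Ring R] [Ring S] (φ : R →+* S) (e : IdemMatrix R) :
    IdemMatrix S where
  size := e.size
  mat := e.mat.map φ
  idem := by rw [← Matrix.map_mul, e.idem]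

/-! ### Graded twisted spectral triples -/

section Triple

variable {H : Type*} [NormedAddCommGroup H] [InnerProductSpace ℂ H]

/-- `R` is the resolvent `(D - z)⁻¹` of the unbounded operator `D` at `z`. -/
def IsResolventAt (D : H →ₗ.[ℂ] H) (z : ℂ) (R : H →L[ℂ] H) : Prop :=
  (∀ x : H, ∃ h : R x ∈ D.domain, D ⟨R x, h⟩ - z • R x = x) ∧
  ∀ x : D.domain, R (D x - z • (x : H)) = x

variable (H) in
/-- A graded `σ`-spectral triple `(𝒜, H, D)` over an involutive algebra `𝒜` with automorphism `σ`,
including the unitarity condition relating `σ` and the involution. -/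
structure GradedTwistedSpectralTriple [CompleteSpace H] (𝒜 : Type*) [Ring 𝒜] [StarRing 𝒜]
    [Algebra ℂ 𝒜] [StarModule ℂ 𝒜] (σ : 𝒜 ≃ₐ[ℂ] 𝒜) where
  /-- the involutive representation -/
  π : 𝒜 →⋆ₐ[ℂ] (H →L[ℂ] H)
  /-- the unbounded self-adjoint operator -/
  D : H →ₗ.[ℂ] H
  selfAdjoint : IsSelfAdjoint D
  compactResolvent : ∃ (z : ℂ) (R : H →L[ℂ] H), IsResolventAt D z R ∧ IsCompactOperator R
  /-- `π a` preserves the domain of `D`, and `D a - σ(a) D` is bounded on it -/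
  bounded : ∀ a : 𝒜, ∃ hdom : ∀ x : D.domain, π a x ∈ D.domain,
    ∃ C : ℝ, ∀ x : D.domain, ‖D ⟨π a x, hdom x⟩ - π (σ a) (D x)‖ ≤ C * ‖(x : H)‖
  /-- the grading operator -/
  γ : H →L[ℂ] H
  γ_selfAdjoint : IsSelfAdjoint γ
  γ_sq : γ * γ = 1
  γ_comm : ∀ a : 𝒜, γ * π a = π a * γ
  γ_anticomm : ∀ x : D.domain, ∃ h : γ x ∈ D.domain, D ⟨γ x, h⟩ = -γ (D x)
  unitarity : ∀ a : 𝒜, σ (star a) = star (σ.symm a)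

namespace GradedTwistedSpectralTriple

variable [CompleteSpace H] {𝒜 : Type*} [Ring 𝒜] [StarRing 𝒜] [Algebra ℂ 𝒜] [StarModule ℂ 𝒜]
  {σ : 𝒜 ≃ₐ[ℂ] 𝒜}

/-- `D` is invertible (with bounded inverse). -/
def Invertible (T : GradedTwistedSpectralTriple H 𝒜 σ) : Prop :=
  ∃ R : H →L[ℂ] H, IsResolventAt T.D 0 R

/-- The bounded operator `D⁻¹`. -/
def Dinv (T : GradedTwistedSpectralTriple H 𝒜 σ) (hD : T.Invertible) : H →L[ℂ] H :=
  hD.choose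

theorem Dinv_apply_D (T : GradedTwistedSpectralTriple H 𝒜 σ) (hD : T.Invertible)
    (x : T.D.domain) : T.Dinv hD (T.D x) = x := by
  have h := hD.choose_spec.2 x
  simpa [Dinv] using h

/-- The densely defined operator `D⁻¹ σ(a) D`, with domain `Dom D`, is bounded, so that its closure
is an everywhere defined bounded operator. -/
theorem exists_twistedConj (T : GradedTwistedSpectralTriple H 𝒜 σ) (hD : T.Invertible) (a : 𝒜) :
    ∃ S : H →L[ℂ] H, ∀ x : T.D.domain, S x = T.Dinv hD (T.π (σ a) (T.D x)) := by
  obtain ⟨hdom, C, hC⟩ := T.bounded a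
  let g : T.D.domain →ₗ[ℂ] H :=
    (T.Dinv hD).toLinearMap ∘ₗ (T.π (σ a)).toLinearMap ∘ₗ T.D.toFun
  have hg : ∀ x : T.D.domain, ‖g x‖ ≤ (‖T.π a‖ + ‖T.Dinv hD‖ * C) * ‖x‖ := by
    intro x
    have e : g x = T.π a x
        - T.Dinv hD (T.D ⟨T.π a x, hdom x⟩ - T.π (σ a) (T.D x)) := by
      rw [map_sub, Dinv_apply_D]
      simp only [sub_sub_cancel]
      rfl
    rw [e]
    refine (norm_sub_le _ _).trans ?_
    have h1 := (T.π a).le_opNorm x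
    have h2 := (T.Dinv hD).le_opNorm (T.D ⟨T.π a x, hdom x⟩ - T.π (σ a) (T.D x))
    have h3 := mul_le_mul_of_nonneg_left (hC x) (norm_nonneg (T.Dinv hD))
    have h4 : ‖(x : H)‖ = ‖x‖ := rfl
    rw [h4] at h1 h3
    linarith
  let G : T.D.domain →L[ℂ] H := g.mkContinuous _ hg
  refine ⟨G.extend (Submodule.subtypeL T.D.domain), fun x => ?_⟩
  exact ContinuousLinearMap.extend_eq G T.selfAdjoint.dense_domain.denseRange_val
    isUniformEmbedding_subtype_val.isUniformInducing x

/-- The bounded closure of `D⁻¹ σ(a) D`. -/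
def twistedConj (T : GradedTwistedSpectralTriple H 𝒜 σ) (hD : T.Invertible) (a : 𝒜) :
    H →L[ℂ] H :=
  (T.exists_twistedConj hD a).choose

/-- The operator on `Hⁿ` given by an `n × n` matrix of operators. -/
def matOp {n : ℕ} (M : Matrix (Fin n) (Fin n) (H →L[ℂ] H)) : (Fin n → H) →L[ℂ] (Fin n → H) :=
  ContinuousLinearMap.pi fun i => ∑ j, (M i j) ∘L (ContinuousLinearMap.proj j)

/-- The action of a matrix over `𝒜` on `Hⁿ`; on `H₊ⁿ ⊕ H₋ⁿ` it is `diag(e₊, e₋)`. -/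
def matRep (T : GradedTwistedSpectralTriple H 𝒜 σ) {n : ℕ} (e : Matrix (Fin n) (Fin n) 𝒜) :
    (Fin n → H) →L[ℂ] (Fin n → H) :=
  matOp (e.map T.π)

/-- The bounded closure of `D⁻¹ σ(e) D` on `Hⁿ`; on `H₊ⁿ ⊕ H₋ⁿ` it is `diag(f₊, f₋)`, with
`f₊`, `f₋` the bounded closures of `D₊⁻¹ σ(e₋) D₊` and `D₋⁻¹ σ(e₊) D₋`. -/
def matTwistedConj (T : GradedTwistedSpectralTriple H 𝒜 σ) (hD : T.Invertible) {n : ℕ}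
    (e : Matrix (Fin n) (Fin n) 𝒜) : (Fin n → H) →L[ℂ] (Fin n → H) :=
  matOp (e.map (T.twistedConj hD))

/-- The subspace `H₊ⁿ` (for `s = 1`) or `H₋ⁿ` (for `s = -1`) of `Hⁿ`. -/
def gradedPart (T : GradedTwistedSpectralTriple H 𝒜 σ) (s : ℤˣ) (n : ℕ) :
    Submodule ℂ (Fin n → H) where
  carrier := {x | ∀ i, T.γ (x i) = (s : ℤ) • x i}
  add_mem' := fun hx hy i => by simp [hx i, hy i]
  zero_mem' := fun i => by simp
  smul_mem' := fun c x hx i => by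
    simp only [Pi.smul_apply, map_smul, hx i]
    exact smul_comm _ _ _

/-- `H₊ⁿ` and `H₋ⁿ` are invariant under matrices over `𝒜`. -/
theorem matRep_mem (T : GradedTwistedSpectralTriple H 𝒜 σ) (s : ℤˣ) {n : ℕ}
    (e : Matrix (Fin n) (Fin n) 𝒜) {x : Fin n → H} (hx : x ∈ T.gradedPart s n) :
    T.matRep e x ∈ T.gradedPart s n := by
  intro i
  have hc : ∀ (a : 𝒜) (v : H), T.γ (T.π a v) = T.π a (T.γ v) := fun a v =>
    congrArg (fun S : H →L[ℂ] H => S v) (T.γ_comm a)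
  simp only [matRep, matOp, ContinuousLinearMap.pi_apply, sum_apply,
    ContinuousLinearMap.comp_apply, ContinuousLinearMap.proj_apply, Matrix.map_apply, map_sum,
    hc, Finset.smul_sum]
  exact Finset.sum_congr rfl fun j _ => by rw [hx j, map_zsmul]

/-- For an idempotent matrix `e` over `𝒜`, the operator
`f₊ e₊ : e₊ H₊ⁿ → f₊ H₊ⁿ` (for `s = 1`) or `f₋ e₋ : e₋ H₋ⁿ → f₋ H₋ⁿ` (for `s = -1`). -/
def indexOp (T : GradedTwistedSpectralTriple H 𝒜 σ) (hD : T.Invertible) (s : ℤˣ)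
    (e : IdemMatrix 𝒜) :
    ((T.gradedPart s e.size).map (T.matRep e.mat).toLinearMap) →L[ℂ]
      ((T.gradedPart s e.size).map (T.matTwistedConj hD e.mat).toLinearMap) :=
  (T.matTwistedConj hD e.mat).restrict (fun _ hx => by
    obtain ⟨y, hy, rfl⟩ := hx
    exact ⟨_, T.matRep_mem s e.mat hy, rfl⟩)

end GradedTwistedSpectralTriple

end Triple

/-! ### One-parameter groups and their analytic extension -/

/-- A strongly continuous one-parameter group of isometric automorphisms of a Banach algebra. -/
structure IsometricOneParameterGroup (A : Type*) [NormedRing A] [NormedAlgebra ℂ A] where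
  toFun : ℝ → (A ≃ₐ[ℂ] A)
  map_zero : ∀ a : A, toFun 0 a = a
  map_add : ∀ (s t : ℝ) (a : A), toFun (s + t) a = toFun s (toFun t a)
  isometric : ∀ (t : ℝ) (a : A), ‖toFun t a‖ = ‖a‖
  stronglyContinuous : ∀ a : A, Continuous fun t => toFun t a

/-- `b = f(a)` in the sense of the holomorphic functional calculus, for `a` an element of a unital
Banach algebra and `f` holomorphic on the open set `U ⊇ Sp(a)`: `b` is the limit of `rₖ(a)` for
rational functions `rₖ = pₖ / qₖ` without poles in `U` that converge to `f` locally uniformly on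
`U`. (By Runge's theorem such rational functions exist, and by the continuity of the functional
calculus the limit is the Cauchy integral of `f` against the resolvent of `a`.) -/
def IsHolomorphicCalculus {B : Type*} [Ring B] [Algebra ℂ B] [TopologicalSpace B]
    (U : Set ℂ) (f : ℂ → ℂ) (a b : B) : Prop :=
  IsOpen U ∧ spectrum ℂ a ⊆ U ∧ DifferentiableOn ℂ f U ∧
  ∃ p q : ℕ → Polynomial ℂ,
    (∀ k, ∀ z ∈ U, (q k).eval z ≠ 0) ∧
    TendstoLocallyUniformlyOn (fun k z => (p k).eval z / (q k).eval z) f atTop U ∧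
    Tendsto (fun k => Polynomial.aeval a (p k) * Ring.inverse (Polynomial.aeval a (q k))) atTop
      (𝓝 b)

section OnePG

variable {A : Type*} [NormedRing A] [NormedAlgebra ℂ A] [StarRing A] [StarModule ℂ A]

/-- `𝒪` is stable under the holomorphic functional calculus of `A`: so is `Mₙ(𝒪)` in `Mₙ(A)`
for every `n`. -/
def StableUnderHolomorphicCalculus (𝒪 : StarSubalgebra ℂ A) : Prop :=
  ∀ (n : ℕ) (U : Set ℂ) (f : ℂ → ℂ) (a b : Matrix (Fin n) (Fin n) A),
    (∀ i j, a i j ∈ 𝒪) → IsHolomorphicCalculus U f a b → ∀ i j, b i j ∈ 𝒪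

/-- The condition (1PG): `𝒪` is a dense `*`-subalgebra of `A`, stable under holomorphic functional
calculus, on which the one-parameter group `τ` extends analytically, and `σ` is the value of this
extension at `t = -i`. -/
structure OnePG (τ : IsometricOneParameterGroup A) (𝒪 : StarSubalgebra ℂ A)
    (σ : 𝒪 ≃ₐ[ℂ] 𝒪) : Prop where
  dense : Dense (𝒪 : Set A)
  stable : StableUnderHolomorphicCalculus 𝒪
  extension : ∀ a : 𝒪, ∃ F : ℂ → A, Differentiable ℂ F ∧
    (∀ t : ℝ, F t = τ.toFun t (a : A)) ∧ F (-Complex.I) = (σ a : A)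

variable (A) in
/-- `K₀(A)` is generated by the classes of self-adjoint projections `p = p² = p*` in matrix algebras
over the involutive algebra `A` (as is the case for every `C*`-algebra). -/
def K0GeneratedByProjections : Prop :=
  AddSubgroup.closure {x : K0 A | ∃ p : IdemMatrix A, p.mat.conjTranspose = p.mat ∧ x = K0.cls p} = ⊤

/-- `I : K₀(A) → ℤ` is the index map `Index^±_{D,σ}` (sign `s = ±1`): for every idempotent matrix
`e` over `𝒪`, the operator `f_± e_±` is Fredholm and `I [e]` is its index. -/
def IsIndexMap {H : Type*} [NormedAddCommGroup H] [InnerProductSpace ℂ H] [CompleteSpace H]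
    {𝒪 : StarSubalgebra ℂ A} {σ : 𝒪 ≃ₐ[ℂ] 𝒪} (T : GradedTwistedSpectralTriple H 𝒪 σ)
    (hD : T.Invertible) (s : ℤˣ) (I : K0 A →+ ℤ) : Prop :=
  ∀ e : IdemMatrix 𝒪, (T.indexOp hD s e).IsFredholm ∧
    I (K0.cls (e.map 𝒪.subtype.toRingHom)) = (T.indexOp hD s e).toLinearMap.index

end OnePG

end

/-! Write `φ(a) = a` and `ψ(a) = D⁻¹ σ(a) D` for the two even representations of `𝒪` on `H`. They
differ by `D⁻¹ (D a - σ(a) D)`, which is compact. Hence `ψ(e) : φ(e)H → ψ(e)H` and `φ(e) : ψ(e)H →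
φ(e)H` are inverse to each other modulo norm limits of finite rank operators. This yields the
Fredholm property, invariance of the index under equivalence over `𝒪`, and additivity. Density and
stability under holomorphic calculus make equivalence classes of idempotents over `𝒪` and over `A`
correspond (`exists_equivalent_map`, `equivalent_of_map_equivalent`), so the index descends uniquely
to `K₀(A)`.

For the sign relation, the pairing `⟨D y, x⟩` couples opposite gradings because `D` is odd. The
unitarity condition makes `φ(a)` and `ψ(σ(a)*)` adjoint for it, and likewise `ψ(a)` and `φ(σ(a)*)`.
So kernels for `σ(e)*` embed in duals of cokernels for `e` with the other sign. Four such
inequalities and the opposite indices of essential inverses force `Index^{-s}(σ(e)*) = -Index^s(e)`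
(`indexOp_index_add_index`).

Finally, the entire extension of the one-parameter group is a path of idempotents over `A` from `e`
to `σ(e)`, so `[σ(e)*] = [e*]` in `K₀(A)`. If `e` is equivalent to a self-adjoint projection, then
also `[e*] = [e]`; such classes generate `K₀(A)`. -/

section LinearIndex

/-! ### Algebraic index of linear maps. -/

namespace LinearMap

variable {k V V' W W' : Type*} [Field k] [AddCommGroup V] [AddCommGroup V'] [AddCommGroup W]
  [AddCommGroup W'] [Module k V] [Module k V'] [Module k W] [Module k W']

/-- Two linear maps intertwined by maps that induce isomorphisms of the kernels and of the
cokernels have the same index. -/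
theorem index_eq_of_intertwine {f : V →ₗ[k] V'} {g : W →ₗ[k] W'} (i : W →ₗ[k] V)
    (j : W' →ₗ[k] V') (hij : ∀ w, j (g w) = f (i w))
    (ker_inj : ∀ w, g w = 0 → i w = 0 → w = 0)
    (ker_surj : ∀ v, f v = 0 → ∃ w, g w = 0 ∧ i w = v)
    (coker_inj : ∀ w', j w' ∈ f.range → w' ∈ g.range)
    (coker_surj : ∀ v', ∃ w', v' - j w' ∈ f.range) : f.index = g.index := by
  have hk : Module.finrank k g.ker = Module.finrank k f.ker := by
    refine LinearEquiv.finrank_eq (LinearEquiv.ofBijective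
      (i.restrict (p := g.ker) (q := f.ker) fun w hw => ?_) ⟨?_, ?_⟩)
    · rw [mem_ker] at hw ⊢
      rw [← hij, hw, map_zero]
    · rw [injective_iff_map_eq_zero]
      rintro ⟨w, hw⟩ h
      exact Subtype.ext (ker_inj w hw (congrArg Subtype.val h))
    · rintro ⟨v, hv⟩
      obtain ⟨w, hw, rfl⟩ := ker_surj v hv
      exact ⟨⟨w, hw⟩, rfl⟩
  have hc : Module.finrank k (W' ⧸ g.range) = Module.finrank k (V' ⧸ f.range) := by
    refine LinearEquiv.finrank_eq (LinearEquiv.ofBijective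
      (g.range.mapQ f.range j ?_) ⟨?_, ?_⟩)
    · rintro _ ⟨w, rfl⟩
      exact ⟨i w, (hij w).symm⟩
    · rw [injective_iff_map_eq_zero]
      intro x hx
      obtain ⟨w', rfl⟩ := g.range.mkQ_surjective x
      rw [Submodule.mkQ_apply, Submodule.mapQ_apply, Submodule.Quotient.mk_eq_zero] at hx
      exact (Submodule.Quotient.mk_eq_zero _).2 (coker_inj w' hx)
    · intro x
      obtain ⟨v', rfl⟩ := f.range.mkQ_surjective x
      obtain ⟨w', hw'⟩ := coker_surj v'
      refine ⟨g.range.mkQ w', ?_⟩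
      rw [Submodule.mkQ_apply, Submodule.mapQ_apply, Submodule.mkQ_apply, eq_comm,
        Submodule.Quotient.eq]
      exact hw'
  rw [index_eq_finrank_sub, index_eq_finrank_sub, hk, hc]

/-- The index is invariant under composition with linear equivalences. -/
theorem index_eq_of_equiv {f : V →ₗ[k] V'} {g : W →ₗ[k] W'} (i : W ≃ₗ[k] V)
    (j : W' ≃ₗ[k] V') (hij : ∀ w, j (g w) = f (i w)) : f.index = g.index := by
  refine index_eq_of_intertwine i.toLinearMap j.toLinearMap hij (fun w _ h => ?_)
    (fun v hv => ⟨i.symm v, ?_, by simp⟩) (fun w' h => ?_) (fun v' => ⟨j.symm v', by simp⟩)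
  · simpa using h
  · apply j.injective
    rw [hij, i.apply_symm_apply, hv, map_zero]
  · obtain ⟨v, hv⟩ := h
    refine ⟨i.symm v, j.injective ?_⟩
    rw [hij, i.apply_symm_apply, hv]
    rfl

/-- Restricting to the range of `F` changes neither kernel nor cokernel, and an endomorphism of a
finite-dimensional space has index zero. -/
theorem index_id_add_of_finiteRange (F : V →ₗ[k] V) (hF : F.range.FG) :
    (LinearMap.id + F).index = 0 := by
  have : FiniteDimensional k F.range := Module.Finite.of_fg hF
  let g : F.range →ₗ[k] F.range := LinearMap.id + F.rangeRestrict ∘ₗ F.range.subtype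
  rw [index_eq_of_intertwine (g := g) F.range.subtype F.range.subtype (fun w => by simp [g])
    (fun w _ h => by simpa using h), index_eq_of_finiteDimensional, sub_self]
  · intro v hv
    have hv' : v = F (-v) := by
      have : v + F v = 0 := hv
      rw [map_neg]; exact eq_neg_of_add_eq_zero_left this
    refine ⟨⟨v, -v, hv'.symm⟩, Subtype.ext ?_, rfl⟩
    simpa [g] using hv
  · rintro ⟨w', u, rfl⟩ ⟨v, hv⟩
    have hv' : v + F v = F u := hv
    refine ⟨⟨v, u - v, ?_⟩, Subtype.ext ?_⟩
    · rw [map_sub, ← hv', add_sub_cancel_right]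
    · simpa [g] using hv
  · exact fun v' => ⟨F.rangeRestrict (-v'), v', by simp⟩

theorem index_prodMap (f : V →ₗ[k] V') (g : W →ₗ[k] W')
    [FiniteDimensional k f.ker] [FiniteDimensional k g.ker]
    [FiniteDimensional k (V' ⧸ f.range)] [FiniteDimensional k (W' ⧸ g.range)] :
    (f.prodMap g).index = f.index + g.index := by
  have hk : Module.finrank k (f.prodMap g).ker
      = Module.finrank k f.ker + Module.finrank k g.ker := by
    rw [← Module.finrank_prod]
    refine (LinearEquiv.finrank_eq (LinearEquiv.ofBijective
      ((f.ker.subtype.prodMap g.ker.subtype).codRestrict (f.prodMap g).ker fun x => ?_)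
      ⟨fun x y h => ?_, ?_⟩)).symm
    · simp
    · have := congrArg Subtype.val h
      exact Prod.ext (Subtype.ext (congrArg Prod.fst this)) (Subtype.ext (congrArg Prod.snd this))
    · rintro ⟨⟨v, w⟩, h⟩
      have h' : f v = 0 ∧ g w = 0 := by simpa using h
      exact ⟨(⟨v, h'.1⟩, ⟨w, h'.2⟩), rfl⟩
  have hc : Module.finrank k ((V' × W') ⧸ (f.prodMap g).range)
      = Module.finrank k (V' ⧸ f.range) + Module.finrank k (W' ⧸ g.range) := by
    rw [← Module.finrank_prod]
    refine LinearEquiv.finrank_eq ((Submodule.quotEquivOfEq _ _ ?_).trans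
      ((f.range.mkQ.prodMap g.range.mkQ).quotKerEquivOfSurjective ?_))
    · rw [range_prodMap, ker_prodMap, Submodule.ker_mkQ, Submodule.ker_mkQ]
    · exact f.range.mkQ_surjective.prodMap g.range.mkQ_surjective
  rw [index_eq_finrank_sub, index_eq_finrank_sub, index_eq_finrank_sub, hk, hc]
  push_cast
  ring

end LinearMap

/-- If the kernel of `u'` embeds conjugate-linearly into the annihilator of the range of `u`, then
its dimension is at most that of the cokernel of `u`. -/
theorem finrank_ker_le_finrank_coker {V V' W W' : Type*} [AddCommGroup V] [AddCommGroup V']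
    [AddCommGroup W] [AddCommGroup W'] [Module ℂ V] [Module ℂ V'] [Module ℂ W] [Module ℂ W']
    (u : V →ₗ[ℂ] V') (u' : W →ₗ[ℂ] W') [FiniteDimensional ℂ u'.ker]
    [FiniteDimensional ℂ (V' ⧸ u.range)] (Φ : u'.ker →ₗ⋆[ℂ] Module.Dual ℂ V')
    (hΦ : ∀ y x, Φ y (u x) = 0) (hinj : ∀ y, Φ y = 0 → y = 0) :
    Module.finrank ℂ u'.ker ≤ Module.finrank ℂ (V' ⧸ u.range) := by
  have hle : ∀ y, u.range ≤ (Φ y).ker := by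
    rintro y _ ⟨x, rfl⟩
    exact hΦ y x
  -- Additivity is enough: linear independence is transported along the pair formed by complex
  -- conjugation on scalars and `Ψ` on vectors.
  let Ψ : u'.ker →+ Module.Dual ℂ (V' ⧸ u.range) :=
    { toFun := fun y => u.range.liftQ (Φ y) (hle y)
      map_zero' := by ext; simp
      map_add' := fun a b => by ext; simp }
  have hli := (Module.finBasis ℂ u'.ker).linearIndependent.map_of_injective_injective
    (starRingEnd ℂ) Ψ (fun r hr => by simpa using hr) (fun y hy => hinj y ?_) (fun r y => ?_)
  · simpa [Subspace.dual_finrank_eq] using hli.fintype_card_le_finrank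
  · ext x
    exact congrArg (fun T => T (u.range.mkQ x)) hy
  · ext x
    simp [Ψ]

end LinearIndex

/-! ### Fredholm theory modulo norm limits of finite rank operators. -/

section Approximable

namespace ContinuousLinearMap

variable {E F G : Type*} [NormedAddCommGroup E] [NormedSpace ℂ E] [NormedAddCommGroup F]
  [NormedSpace ℂ F] [NormedAddCommGroup G] [NormedSpace ℂ G]

/-- Norm limits of operators of finite rank. -/
def IsApproximable (u : E →L[ℂ] F) : Prop :=
  ∀ ε > 0, ∃ v : E →L[ℂ] F, v.toLinearMap.HasFiniteRange ∧ ‖u - v‖ < ε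

theorem IsApproximable.zero : (0 : E →L[ℂ] F).IsApproximable :=
  fun ε hε => ⟨0, LinearMap.HasFiniteRange.zero, by simpa using hε⟩

theorem IsApproximable.add {u v : E →L[ℂ] F} (hu : u.IsApproximable) (hv : v.IsApproximable) :
    (u + v).IsApproximable := by
  intro ε hε
  obtain ⟨u', hu', h₁⟩ := hu (ε / 2) (half_pos hε)
  obtain ⟨v', hv', h₂⟩ := hv (ε / 2) (half_pos hε)
  refine ⟨u' + v', hu'.add hv', ?_⟩
  rw [add_sub_add_comm]
  exact (norm_add_le _ _).trans_lt (by linarith)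

theorem IsApproximable.neg {u : E →L[ℂ] F} (hu : u.IsApproximable) : (-u).IsApproximable := by
  intro ε hε
  obtain ⟨u', hu', h₁⟩ := hu ε hε
  refine ⟨-u', hu'.neg, ?_⟩
  rwa [← neg_sub', norm_neg]

theorem IsApproximable.sum {ι : Type*} (s : Finset ι) {u : ι → E →L[ℂ] F}
    (hu : ∀ i ∈ s, (u i).IsApproximable) : (∑ i ∈ s, u i).IsApproximable :=
  Finset.sum_induction u _ (fun _ _ => IsApproximable.add) IsApproximable.zero hu

theorem IsApproximable.comp_left {u : E →L[ℂ] F} (hu : u.IsApproximable) (v : F →L[ℂ] G) :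
    (v ∘L u).IsApproximable := by
  intro ε hε
  have hp : 0 < ‖v‖ + 1 := by positivity
  obtain ⟨u', hu', h₁⟩ := hu (ε / (‖v‖ + 1)) (div_pos hε hp)
  refine ⟨v ∘L u', hu'.comp_left v.toLinearMap, ?_⟩
  rw [← comp_sub]
  refine (opNorm_comp_le _ _).trans_lt ?_
  rw [lt_div_iff₀ hp] at h₁
  nlinarith [norm_nonneg (u - u')]

theorem IsApproximable.comp_right {v : F →L[ℂ] G} (hv : v.IsApproximable) (u : E →L[ℂ] F) :
    (v ∘L u).IsApproximable := by
  intro ε hε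
  have hp : 0 < ‖u‖ + 1 := by positivity
  obtain ⟨v', hv', h₁⟩ := hv (ε / (‖u‖ + 1)) (div_pos hε hp)
  refine ⟨v' ∘L u, hv'.comp_right u.toLinearMap, ?_⟩
  rw [← sub_comp]
  refine (opNorm_comp_le _ _).trans_lt ?_
  rw [lt_div_iff₀ hp] at h₁
  nlinarith [norm_nonneg (v - v')]

/-- A compact operator into a Hilbert space is a norm limit of operators of finite rank. -/
theorem IsApproximable.of_isCompactOperator {H : Type*} [NormedAddCommGroup H]
    [InnerProductSpace ℂ H] {u : E →L[ℂ] H} (hu : IsCompactOperator u) : u.IsApproximable := by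
  intro ε hε
  have htb := (hu.isCompact_closure_image_closedBall (f := u.toLinearMap) 1).totallyBounded
  -- Project onto the span of a finite `ε/2`-net of the image of the unit ball; the projection is at
  -- least as close to `u x` as the net point.
  obtain ⟨t, ht, hcov⟩ := Metric.totallyBounded_iff.1 htb (ε / 2) (half_pos hε)
  let U := Submodule.span ℂ t
  have : FiniteDimensional ℂ U := FiniteDimensional.span_of_finite ℂ ht
  refine ⟨U.starProjection ∘L u, ?_, ?_⟩
  · refine LinearMap.HasFiniteRange.comp_right ?_ u.toLinearMap
    rw [LinearMap.HasFiniteRange, Submodule.range_starProjection]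
    exact Submodule.fg_span ht
  · refine lt_of_le_of_lt ?_ (half_lt_self hε)
    refine opNorm_le_of_unit_norm (𝕜 := ℂ) (half_pos hε).le fun x hx => ?_
    have hmem : u x ∈ closure (u.toLinearMap '' Metric.closedBall 0 1) :=
      subset_closure ⟨x, by simp [hx], rfl⟩
    obtain ⟨y, hy, hxy⟩ := Set.mem_iUnion₂.1 (hcov hmem)
    have hmin : ‖u x - U.starProjection (u x)‖ ≤ ‖u x - y‖ := by
      rw [U.starProjection_minimal]
      exact ciInf_le ⟨0, by rintro _ ⟨z, rfl⟩; exact norm_nonneg _⟩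
        (⟨y, Submodule.subset_span hy⟩ : U)
    exact hmin.trans (by simpa [dist_eq_norm] using (Metric.mem_ball.1 hxy).le)

open LinearMap.FiniteRangeSetoid in
/-- An approximable perturbation of the identity of a Banach space is Fredholm of index zero. -/
theorem IsApproximable.isFredholm_id_add [CompleteSpace E] {K : E →L[ℂ] E}
    (hK : K.IsApproximable) :
    (ContinuousLinearMap.id ℂ E + K).IsFredholm ∧
      (ContinuousLinearMap.id ℂ E + K).toLinearMap.index = 0 := by
  -- With `‖K - F‖ < 1`, the operator `w = 1 + (K - F)` is invertible and `1 + K = w (1 + w⁻¹ F)`,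
  -- which reduces everything to a finite rank perturbation of the identity.
  obtain ⟨F, hF, hlt⟩ := hK 1 one_pos
  obtain ⟨w, hw⟩ : IsUnit (1 + (K - F)) := by
    have h := isUnit_one_sub_of_norm_lt_one (x := -(K - F)) (by rwa [norm_neg])
    rwa [sub_neg_eq_add] at h
  have e₁ : ContinuousLinearMap.id ℂ E + K = w.val * (1 + w.inv * F) := by
    rw [mul_add, ← mul_assoc, w.val_inv, mul_one, one_mul, hw]
    change 1 + K = _
    abel
  have hF' : (w.inv * F).toLinearMap.HasFiniteRange := hF.comp_left w.inv.toLinearMap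
  constructor
  · refine IsFredholm.of_isQuasiInverse (v := w.inv) ⟨?_, ?_⟩
    · rw [LinearMap.IsLeftQuasiInverse, equiv_iff_hasFiniteRange]
      have : w.inv * (ContinuousLinearMap.id ℂ E + K) - 1 = w.inv * F := by
        rw [e₁, ← mul_assoc, w.inv_val, one_mul, add_sub_cancel_left]
      rw [← this] at hF'
      exact hF'
    · rw [LinearMap.IsRightQuasiInverse, equiv_iff_hasFiniteRange]
      have hF₂ : (F * w.inv).toLinearMap.HasFiniteRange := hF.comp_right w.inv.toLinearMap
      have : (ContinuousLinearMap.id ℂ E + K) * w.inv - 1 = F * w.inv := by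
        have : ContinuousLinearMap.id ℂ E + K = w.val + F := by
          rw [hw]
          change 1 + K = _
          abel
        rw [this, add_mul, w.val_inv, add_sub_cancel_left]
      rw [← this] at hF₂
      exact hF₂
  · have hbij : ∀ x, w.inv (w.val x) = x := fun x => congrArg (fun T : E →L[ℂ] E => T x) w.inv_val
    have hbij' : ∀ x, w.val (w.inv x) = x := fun x => congrArg (fun T : E →L[ℂ] E => T x) w.val_inv
    rw [← LinearMap.index_id_add_of_finiteRange _ hF']
    refine LinearMap.index_eq_of_equiv (LinearEquiv.refl ℂ E)
      (LinearEquiv.ofBijective w.val.toLinearMap ⟨?_, ?_⟩) fun x => ?_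
    · exact Function.LeftInverse.injective hbij
    · exact Function.RightInverse.surjective hbij'
    · exact (congrArg (fun T : E →L[ℂ] E => T x) e₁).symm

theorem IsFredholm.finiteDimensional_ker {u : E →L[ℂ] F} (h : u.IsFredholm) :
    FiniteDimensional ℂ u.toLinearMap.ker :=
  h.finite_ker

theorem IsFredholm.finiteDimensional_coker {u : E →L[ℂ] F} (h : u.IsFredholm) :
    FiniteDimensional ℂ (F ⧸ u.toLinearMap.range) :=
  h.finite_coker

/-- `u` and `v` are inverse to each other modulo approximable operators. -/
def IsEssInverse (u : E →L[ℂ] F) (v : F →L[ℂ] E) : Prop :=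
  (v ∘L u - ContinuousLinearMap.id ℂ E).IsApproximable ∧
    (u ∘L v - ContinuousLinearMap.id ℂ F).IsApproximable

theorem IsEssInverse.symm {u : E →L[ℂ] F} {v : F →L[ℂ] E} (h : u.IsEssInverse v) :
    v.IsEssInverse u :=
  ⟨h.2, h.1⟩

theorem IsEssInverse.congr {u u' : E →L[ℂ] F} {v : F →L[ℂ] E} (h : u.IsEssInverse v)
    (hu : (u' - u).IsApproximable) : u'.IsEssInverse v := by
  refine ⟨?_, ?_⟩
  · have : v ∘L u' - ContinuousLinearMap.id ℂ E
        = (v ∘L u - ContinuousLinearMap.id ℂ E) + v ∘L (u' - u) := by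
      rw [comp_sub]; abel
    exact this ▸ h.1.add (hu.comp_left v)
  · have : u' ∘L v - ContinuousLinearMap.id ℂ F
        = (u ∘L v - ContinuousLinearMap.id ℂ F) + (u' - u) ∘L v := by
      rw [sub_comp]; abel
    exact this ▸ h.2.add (hu.comp_right v)

variable [CompleteSpace E] [CompleteSpace F]

-- Since `v u` and `u v` are Fredholm, `u` has a left and a right quasi-inverse modulo finite rank.
-- These agree modulo finite rank, so either one is two-sided.
open LinearMap.FiniteRangeSetoid in
theorem IsEssInverse.isFredholm {u : E →L[ℂ] F} {v : F →L[ℂ] E} (h : u.IsEssInverse v) :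
    u.IsFredholm := by
  have h₁ := h.1.isFredholm_id_add.1
  have h₂ := h.2.isFredholm_id_add.1
  rw [add_sub_cancel] at h₁ h₂
  obtain ⟨a, ha, -⟩ := h₁.exists_isQuasiInverse
  obtain ⟨b, -, hb⟩ := h₂.exists_isQuasiInverse
  have ha' : (a ∘L v).toLinearMap ∘ₗ u.toLinearMap ≈ LinearMap.id := ha
  have hb' : u.toLinearMap ∘ₗ (v ∘L b).toLinearMap ≈ LinearMap.id := hb
  have hab : (a ∘L v).toLinearMap ≈ (v ∘L b).toLinearMap := by
    have e₁ := LinearMap.FiniteRangeSetoid.equiv_comp_left (u' := (a ∘L v).toLinearMap) hb'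
    have e₂ := LinearMap.FiniteRangeSetoid.equiv_comp_right (u := (v ∘L b).toLinearMap) ha'
    exact Setoid.trans (Setoid.symm e₁) e₂
  refine IsFredholm.of_isQuasiInverse (v := a ∘L v) ⟨ha', ?_⟩
  exact Setoid.trans (LinearMap.FiniteRangeSetoid.equiv_comp_left (u' := u.toLinearMap) hab) hb'

theorem IsEssInverse.index_add_index {u : E →L[ℂ] F} {v : F →L[ℂ] E} (h : u.IsEssInverse v) :
    u.toLinearMap.index + v.toLinearMap.index = 0 := by
  have := h.isFredholm.finiteDimensional_ker
  have := h.isFredholm.finiteDimensional_coker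
  have := h.symm.isFredholm.finiteDimensional_ker
  have := h.symm.isFredholm.finiteDimensional_coker
  have h₁ := h.1.isFredholm_id_add.2
  rw [add_sub_cancel] at h₁
  have h₂ : (v.toLinearMap ∘ₗ u.toLinearMap).index = 0 := h₁
  rw [LinearMap.index_comp] at h₂
  rw [add_comm, h₂]

/-- Both `u` and `u'` have `v` as essential inverse, so both indices equal minus that of `v`. -/
theorem IsEssInverse.index_congr {u u' : E →L[ℂ] F} {v : F →L[ℂ] E} (h : u.IsEssInverse v)
    (hu : (u' - u).IsApproximable) : u'.toLinearMap.index = u.toLinearMap.index := by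
  have h₁ := h.index_add_index
  have h₂ := (h.congr hu).index_add_index
  lia

end ContinuousLinearMap

end Approximable

/-! ### Equivalence of idempotent matrices and the universal property of `K₀`. -/

section EquivalentIdempotents

namespace IdemMatrix

variable {R S : Type*} [Ring R] [Ring S]

theorem Equivalent.refl (e : IdemMatrix R) : e.Equivalent e :=
  ⟨e.mat, e.mat, e.idem, e.idem⟩

theorem Equivalent.symm {e f : IdemMatrix R} (h : e.Equivalent f) : f.Equivalent e := by
  obtain ⟨x, y, hxy, hyx⟩ := h
  exact ⟨y, x, hyx, hxy⟩

theorem Equivalent.trans {e f g : IdemMatrix R} (h : e.Equivalent f) (h' : f.Equivalent g) :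
    e.Equivalent g := by
  obtain ⟨x, y, hxy, hyx⟩ := h
  obtain ⟨z, w, hzw, hwz⟩ := h'
  refine ⟨x * z, w * y, ?_, ?_⟩
  · calc x * z * (w * y) = x * (z * w) * y := by simp only [Matrix.mul_assoc]
      _ = (x * y) * (x * y) := by rw [hzw, ← hyx]; simp only [Matrix.mul_assoc]
      _ = e.mat := by rw [hxy, e.idem]
  · calc w * y * (x * z) = w * (y * x) * z := by simp only [Matrix.mul_assoc]
      _ = (w * z) * (w * z) := by rw [hyx, ← hzw]; simp only [Matrix.mul_assoc]
      _ = g.mat := by rw [hwz, g.idem]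

theorem Equivalent.blockSum {e e' f f' : IdemMatrix R} (h : e.Equivalent e')
    (h' : f.Equivalent f') : (e.blockSum f).Equivalent (e'.blockSum f') := by
  obtain ⟨x, y, hxy, hyx⟩ := h
  obtain ⟨z, w, hzw, hwz⟩ := h'
  refine ⟨(Matrix.fromBlocks x 0 0 z).submatrix finSumFinEquiv.symm finSumFinEquiv.symm,
    (Matrix.fromBlocks y 0 0 w).submatrix finSumFinEquiv.symm finSumFinEquiv.symm, ?_, ?_⟩
  · refine (Matrix.submatrix_mul_equiv _ _ _ finSumFinEquiv.symm _).trans ?_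
    rw [Matrix.fromBlocks_multiply]
    simp [IdemMatrix.blockSum, hxy, hzw]
  · refine (Matrix.submatrix_mul_equiv _ _ _ finSumFinEquiv.symm _).trans ?_
    rw [Matrix.fromBlocks_multiply]
    simp [IdemMatrix.blockSum, hyx, hwz]

theorem map_blockSum (φ : R →+* S) (e f : IdemMatrix R) :
    (e.blockSum f).map φ = (e.map φ).blockSum (f.map φ) := by
  have h : ((e.blockSum f).map φ).mat = ((e.map φ).blockSum (f.map φ)).mat := by
    simp only [IdemMatrix.map, IdemMatrix.blockSum]
    rw [← Matrix.submatrix_map, Matrix.fromBlocks_map]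
    simp
  simp only [IdemMatrix.map, IdemMatrix.blockSum] at h ⊢
  congr 1

/-- The conjugate transpose of an idempotent matrix. -/
def adjoint [StarRing R] (e : IdemMatrix R) : IdemMatrix R where
  size := e.size
  mat := e.mat.conjTranspose
  idem := by rw [← Matrix.conjTranspose_mul, e.idem]

theorem Equivalent.adjoint [StarRing R] {e f : IdemMatrix R} (h : e.Equivalent f) :
    e.adjoint.Equivalent f.adjoint := by
  obtain ⟨x, y, hxy, hyx⟩ := h
  refine ⟨y.conjTranspose, x.conjTranspose, ?_, ?_⟩
  · exact (Matrix.conjTranspose_mul x y).symm.trans (congrArg Matrix.conjTranspose hxy)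
  · exact (Matrix.conjTranspose_mul y x).symm.trans (congrArg Matrix.conjTranspose hyx)

end IdemMatrix

namespace K0

variable {R : Type*} [Ring R]

theorem cls_eq_of_equivalent {e f : IdemMatrix R} (h : e.Equivalent f) : cls e = cls f := by
  refine (QuotientAddGroup.eq_iff_sub_mem).2 (AddSubgroup.subset_closure ?_)
  exact Or.inl ⟨e, f, h, rfl⟩

/-- A homomorphism out of `K₀(R)` is an additive invariant of idempotent matrices. -/
def lift {G : Type*} [AddCommGroup G] (φ : IdemMatrix R → G)
    (h : ∀ e f : IdemMatrix R, e.Equivalent f → φ e = φ f)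
    (h' : ∀ e f : IdemMatrix R, φ (e.blockSum f) = φ e + φ f) : K0 R →+ G :=
  QuotientAddGroup.lift _ (FreeAbelianGroup.lift φ) (by
    rw [AddSubgroup.closure_le]
    rintro _ (⟨e, f, hef, rfl⟩ | ⟨e, f, rfl⟩)
    · simp [h e f hef]
    · simp [h' e f])

theorem lift_cls {G : Type*} [AddCommGroup G] (φ : IdemMatrix R → G)
    (h : ∀ e f : IdemMatrix R, e.Equivalent f → φ e = φ f)
    (h' : ∀ e f : IdemMatrix R, φ (e.blockSum f) = φ e + φ f) (e : IdemMatrix R) :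
    lift φ h h' (cls e) = φ e :=
  (QuotientAddGroup.lift_mk _ _ _).trans (FreeAbelianGroup.lift_apply_of _ _)

theorem hom_ext {G : Type*} [AddCommGroup G] {φ ψ : K0 R →+ G}
    (h : ∀ e, φ (cls e) = ψ (cls e)) : φ = ψ :=
  QuotientAddGroup.addMonoidHom_ext _ (FreeAbelianGroup.lift_ext _ _ h)

end K0

end EquivalentIdempotents

/-! ### Idempotents in dense subsets stable under holomorphic functional calculus. -/

section IdempotentLifting

variable {B : Type*} [NormedRing B]

/-- Idempotents that are close to each other are equivalent. -/
theorem exists_equivalent_of_norm_lt_one [CompleteSpace B] {e b : B} (he : e * e = e)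
    (hb : b * b = b) (h : ‖(2 * e - 1) * (b - e)‖ < 1) : ∃ x y : B, x * y = e ∧ y * x = b := by
  have hu := isUnit_one_sub_of_norm_lt_one (x := -((2 * e - 1) * (b - e))) (by rwa [norm_neg])
  -- The right-hand side `w` satisfies `w b = e w`; the norm bound makes it invertible, so it
  -- conjugates `b` to `e`.
  have hw : 1 - -((2 * e - 1) * (b - e)) = e * b + (1 - e) * (1 - b) := by
    have : 1 - -((2 * e - 1) * (b - e)) = e * b + (1 - e) * (1 - b) - 2 * (e * e - e) := by
      noncomm_ring
    rw [this, he]; simp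
  rw [hw] at hu
  obtain ⟨w, hw'⟩ := hu
  have h₁ : w.val * b = e * w.val := by
    rw [hw']
    have e₁ : (1 - b) * b = 0 := by rw [sub_mul, hb, one_mul, sub_self]
    have e₂ : e * (1 - e) = 0 := by rw [mul_sub, he, mul_one, sub_self]
    rw [add_mul, mul_add, mul_assoc, mul_assoc, e₁, ← mul_assoc e e, ← mul_assoc e (1 - e), e₂,
      hb, he]
    simp
  refine ⟨w.val * b, b * w.inv, ?_, ?_⟩
  · rw [mul_assoc, ← mul_assoc b b, hb, ← mul_assoc, h₁, mul_assoc, w.val_inv, mul_one]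
  · rw [mul_assoc, ← mul_assoc w.inv, w.inv_val, one_mul, hb]

/-- The iterates of the polynomial `3X² - 2X³`. -/
noncomputable def idemPoly : ℕ → Polynomial ℂ
  | 0 => Polynomial.X
  | k + 1 => 3 * idemPoly k ^ 2 - 2 * idemPoly k ^ 3

variable [NormedAlgebra ℂ B]

theorem aeval_idemPoly_succ (a : B) (k : ℕ) : Polynomial.aeval a (idemPoly (k + 1))
    = 3 * Polynomial.aeval a (idemPoly k) ^ 2 - 2 * Polynomial.aeval a (idemPoly k) ^ 3 := by
  simp [idemPoly, map_ofNat]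

/-- For `w = x - x²`, one iteration turns the defect `w` into `3w² + 4w³` and `1 - 2x` into `(1 -
2x)(1 + 2w)`. The rates `1/4` and `2` are crude, but their product `1/2` suffices for geometric
convergence. -/
theorem norm_idemPoly_le {a : B} {δ : ℝ} (hδ : δ ≤ 1 / 100) (ha : ‖a - a ^ 2‖ ≤ δ) (k : ℕ) :
    ‖Polynomial.aeval a (idemPoly k) - Polynomial.aeval a (idemPoly k) ^ 2‖ ≤ δ / 4 ^ k ∧
      ‖1 - 2 * Polynomial.aeval a (idemPoly k)‖ ≤ ‖1 - 2 * a‖ * 2 ^ k := by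
  have hδ0 : 0 ≤ δ := (norm_nonneg _).trans ha
  induction k with
  | zero => simpa [idemPoly] using ha
  | succ k ih =>
    rw [aeval_idemPoly_succ]
    set x := Polynomial.aeval a (idemPoly k)
    obtain ⟨h₁, h₂⟩ := ih
    set w := x - x ^ 2 with hw
    have hk : δ / 4 ^ k ≤ 1 / 100 :=
      (div_le_self hδ0 (one_le_pow₀ (by norm_num))).trans hδ
    have hw1 : ‖w‖ ≤ 1 / 100 := h₁.trans hk
    have hn := norm_nonneg w
    constructor
    · have e₁ : 3 * x ^ 2 - 2 * x ^ 3 - (3 * x ^ 2 - 2 * x ^ 3) ^ 2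
          = (3 : ℕ) • (w * w) + (4 : ℕ) • (w * w * w) := by
        rw [hw]; noncomm_ring
      have e₂ : ‖w * w‖ ≤ ‖w‖ * ‖w‖ := norm_mul_le _ _
      have e₃ : ‖w * w * w‖ ≤ ‖w‖ * ‖w‖ * ‖w‖ := norm_mul₃_le
      have e₄ : ‖(3 : ℕ) • (w * w)‖ ≤ 3 * (‖w‖ * ‖w‖) := by
        refine (norm_nsmul_le).trans ?_
        push_cast; linarith
      have e₅ : ‖(4 : ℕ) • (w * w * w)‖ ≤ 4 * (‖w‖ * ‖w‖ * ‖w‖) := by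
        refine (norm_nsmul_le).trans ?_
        push_cast; linarith
      have e₆ : ‖w‖ * ‖w‖ ≤ 1 / 100 * ‖w‖ := mul_le_mul_of_nonneg_right hw1 hn
      have e₇ : ‖w‖ * ‖w‖ * ‖w‖ ≤ 1 / 100 * ‖w‖ := by
        refine mul_le_mul_of_nonneg_right ?_ hn
        nlinarith
      rw [e₁, pow_succ, ← div_div, le_div_iff₀ (by norm_num)]
      have := norm_add_le ((3 : ℕ) • (w * w)) ((4 : ℕ) • (w * w * w))
      linarith
    · have e₁ : 1 - 2 * (3 * x ^ 2 - 2 * x ^ 3)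
          = (1 - 2 * x) + (2 : ℕ) • ((1 - 2 * x) * w) := by
        rw [hw]; noncomm_ring
      have e₂ : ‖(2 : ℕ) • ((1 - 2 * x) * w)‖ ≤ 2 * (‖1 - 2 * x‖ * ‖w‖) := by
        refine (norm_nsmul_le).trans ?_
        have := norm_mul_le (1 - 2 * x) w
        push_cast; linarith
      have e₃ : ‖1 - 2 * x‖ * ‖w‖ ≤ ‖1 - 2 * x‖ * (1 / 100) :=
        mul_le_mul_of_nonneg_left hw1 (norm_nonneg _)
      rw [e₁, pow_succ, ← mul_assoc]
      have := norm_add_le (1 - 2 * x) ((2 : ℕ) • ((1 - 2 * x) * w))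
      have := norm_nonneg (1 - 2 * x)
      linarith

/-- One iteration moves `x` by `(x - x²)(1 - 2x)`, to which both previous bounds apply. The bound is
written as `C / 2 / 2 ^ k` to fit the criterion for geometric Cauchy sequences. -/
theorem dist_idemPoly_le {a : B} {δ : ℝ} (hδ : δ ≤ 1 / 100) (ha : ‖a - a ^ 2‖ ≤ δ) (k : ℕ) :
    dist (Polynomial.aeval a (idemPoly k)) (Polynomial.aeval a (idemPoly (k + 1)))
      ≤ 2 * (δ * ‖1 - 2 * a‖) / 2 / 2 ^ k := by
  have hδ0 : 0 ≤ δ := (norm_nonneg _).trans ha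
  obtain ⟨h₁, h₂⟩ := norm_idemPoly_le hδ ha k
  rw [aeval_idemPoly_succ, dist_eq_norm]
  set x := Polynomial.aeval a (idemPoly k)
  have e₁ : x - (3 * x ^ 2 - 2 * x ^ 3) = (x - x ^ 2) * (1 - 2 * x) := by noncomm_ring
  rw [e₁]
  refine (norm_mul_le _ _).trans ((mul_le_mul h₁ h₂ (norm_nonneg _) (by positivity)).trans ?_)
  have : (4 : ℝ) ^ k = 2 ^ k * 2 ^ k := by rw [← mul_pow]; norm_num
  rw [this]
  apply le_of_eq
  field_simp

/-- Under the iteration of `3X² - 2X³`, almost idempotent elements converge to idempotents. -/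
theorem exists_tendsto_idemPoly [CompleteSpace B] {a : B} {δ : ℝ} (hδ : δ ≤ 1 / 100)
    (ha : ‖a - a ^ 2‖ ≤ δ) :
    ∃ b : B, Tendsto (fun k => Polynomial.aeval a (idemPoly k)) atTop (𝓝 b) ∧ b * b = b ∧
      ∀ k, dist (Polynomial.aeval a (idemPoly k)) b ≤ 2 * (δ * ‖1 - 2 * a‖) / 2 ^ k := by
  obtain ⟨b, hb⟩ := cauchySeq_tendsto_of_complete
    (cauchySeq_of_le_geometric_two (dist_idemPoly_le hδ ha))
  refine ⟨b, hb, ?_, dist_le_of_le_geometric_two_of_tendsto (dist_idemPoly_le hδ ha) hb⟩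
  have h₁ : Tendsto (fun k => Polynomial.aeval a (idemPoly k)
      - Polynomial.aeval a (idemPoly k) ^ 2) atTop (𝓝 (b - b ^ 2)) := hb.sub (hb.pow 2)
  have h₂ : Tendsto (fun k => Polynomial.aeval a (idemPoly k)
      - Polynomial.aeval a (idemPoly k) ^ 2) atTop (𝓝 0) := by
    refine squeeze_zero_norm (fun k => (norm_idemPoly_le hδ ha k).1) ?_
    have := (tendsto_pow_atTop_nhds_zero_of_lt_one (r := (1 / 4 : ℝ)) (by norm_num)
      (by norm_num)).const_mul δ
    simpa [div_eq_mul_inv] using this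
  have h₃ := tendsto_nhds_unique h₁ h₂
  rw [← pow_two]
  exact (sub_eq_zero.1 h₃).symm

/-- The limit of the iteration of `3X² - 2X³` is obtained by holomorphic functional calculus. -/
theorem isHolomorphicCalculus_idemPoly [CompleteSpace B] {a b : B}
    (ha : ‖a - a ^ 2‖ * ‖(1 : B)‖ < 1 / 100)
    (hb : Tendsto (fun k => Polynomial.aeval a (idemPoly k)) atTop (𝓝 b)) :
    ∃ (U : Set ℂ) (f : ℂ → ℂ), IsHolomorphicCalculus U f a b := by
  classical
  -- On `U` the scalar iteration converges uniformly. The spectrum of `a` lies in `U` by spectral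
  -- mapping for `X - X²`; the factor `‖1‖` in the hypothesis is there because the unit need not
  -- have norm one.
  let U : Set ℂ := {z | ‖z - z ^ 2‖ < 1 / 100}
  have hU : IsOpen U := isOpen_lt (by fun_prop) continuous_const
  have hex : ∀ z : ℂ, ∃ w : ℂ, z ∈ U → ∀ k, dist ((idemPoly k).eval z) w ≤ 1 / 2 ^ k := by
    intro z
    by_cases hz : z ∈ U
    · obtain ⟨w, -, -, hw⟩ := exists_tendsto_idemPoly (a := z) le_rfl (le_of_lt hz)
      refine ⟨w, fun _ k => ?_⟩
      -- The identity `(1 - 2z)² = 1 - 4(z - z²)` bounds `1 - 2z` uniformly on `U`, hence also the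
      -- rate of convergence.
      have h₁ : ‖1 - 2 * z‖ ^ 2 ≤ 2 ^ 2 := by
        rw [← norm_pow, show (1 - 2 * z) ^ 2 = 1 - 4 * (z - z ^ 2) by ring]
        refine (norm_sub_le _ _).trans ?_
        rw [norm_mul, norm_one, Complex.norm_ofNat]
        have : ‖z - z ^ 2‖ < 1 / 100 := hz
        linarith
      have h₂ : ‖1 - 2 * z‖ ≤ 2 := le_of_sq_le_sq h₁ (by norm_num)
      have h₃ := hw k
      rw [Polynomial.coe_aeval_eq_eval] at h₃
      refine h₃.trans ?_
      gcongr
      linarith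
    · exact ⟨0, fun h => absurd h hz⟩
  choose f hf using hex
  have hlim : TendstoLocallyUniformlyOn (fun k z => (idemPoly k).eval z) f atTop U := by
    refine TendstoUniformlyOn.tendstoLocallyUniformlyOn ?_
    rw [Metric.tendstoUniformlyOn_iff]
    intro ε hε
    have h0 : Tendsto (fun k : ℕ => 1 / (2 : ℝ) ^ k) atTop (𝓝 0) := by
      simpa using tendsto_pow_atTop_nhds_zero_of_lt_one (r := (1 / 2 : ℝ)) (by norm_num)
        (by norm_num)
    filter_upwards [h0.eventually_lt_const hε] with k hk z hz
    rw [dist_comm]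
    exact (hf z hz k).trans_lt hk
  refine ⟨U, f, hU, fun z hz => ?_, ?_, idemPoly, fun _ => 1, by simp, by simpa using hlim, ?_⟩
  · have h₁ := spectrum.subset_polynomial_aeval a (Polynomial.X - Polynomial.X ^ 2) ⟨z, hz, rfl⟩
    have h₂ := spectrum.norm_le_norm_mul_of_mem h₁
    simp only [Polynomial.eval_sub, Polynomial.eval_X, Polynomial.eval_pow, map_sub, map_pow,
      Polynomial.aeval_X] at h₂
    exact h₂.trans_lt ha
  · exact hlim.differentiableOn (Eventually.of_forall fun k => (idemPoly k).differentiableOn) hU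
  · simpa using hb

/-- Every idempotent is equivalent to one in a given dense subset that is stable under holomorphic
functional calculus. -/
theorem exists_idempotent_mem_of_dense [CompleteSpace B] {S : Set B} (hS : Dense S)
    (hol : ∀ U f a b, a ∈ S → IsHolomorphicCalculus U f a b → b ∈ S) {e : B} (he : e * e = e) :
    ∃ b ∈ S, b * b = b ∧ ∃ x y : B, x * y = e ∧ y * x = b := by
  -- The three conditions give convergence of the iteration from `a`, inclusion of the spectrum of
  -- `a` in `U`, and closeness of the limit `b` to `e`, since `‖b - a‖ ≤ 2 ‖a - a²‖ ‖1 - 2a‖`. They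
  -- are open and hold at `a = e`.
  let V : Set B := {a | ‖a - a ^ 2‖ < 1 / 100 ∧ ‖a - a ^ 2‖ * ‖(1 : B)‖ < 1 / 100 ∧
    ‖2 * e - 1‖ * (2 * (‖a - a ^ 2‖ * ‖1 - 2 * a‖) + ‖a - e‖) < 1}
  have hV : IsOpen V := by
    simp only [V, Set.ofPred_and]
    refine IsOpen.inter ?_ (IsOpen.inter ?_ ?_) <;> exact isOpen_lt (by fun_prop) continuous_const
  have heV : e ∈ V := by simp [V, pow_two, he]
  obtain ⟨a, ⟨h₁, h₂, h₃⟩, haS⟩ := hS.inter_open_nonempty V hV ⟨e, heV⟩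
  obtain ⟨b, hb, hbb, hdist⟩ := exists_tendsto_idemPoly h₁.le le_rfl
  obtain ⟨U, f, hcalc⟩ := isHolomorphicCalculus_idemPoly h₂ hb
  refine ⟨b, hol U f a b haS hcalc, hbb, exists_equivalent_of_norm_lt_one he hbb ?_⟩
  refine (norm_mul_le _ _).trans_lt (lt_of_le_of_lt ?_ h₃)
  gcongr
  have h₄ := hdist 0
  simp only [idemPoly, Polynomial.aeval_X, pow_zero, div_one] at h₄
  rw [dist_comm, dist_eq_norm] at h₄
  linarith [norm_sub_le_norm_sub_add_norm_sub b a e]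

/-- The function `z⁻¹` on the complement of `0` is itself the rational function `1 / X`, so a
constant sequence of approximants works. -/
theorem inverse_mem_of_isHolomorphicCalculus {S : Set B}
    (hol : ∀ U f a b, a ∈ S → IsHolomorphicCalculus U f a b → b ∈ S) {a : B} (ha : a ∈ S)
    (hu : IsUnit a) : Ring.inverse a ∈ S := by
  refine hol {0}ᶜ (fun z => z⁻¹) a _ ha ⟨isOpen_compl_singleton, ?_, ?_, fun _ => 1,
    fun _ => Polynomial.X, fun _ z hz => by simpa using hz, ?_, by simp⟩
  · rintro z hz rfl
    exact (spectrum.zero_mem_iff ℂ).1 hz hu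
  · exact fun z hz => (differentiableAt_inv hz).differentiableWithinAt
  · refine TendstoUniformlyOn.tendstoLocallyUniformlyOn ?_
    rw [Metric.tendstoUniformlyOn_iff]
    intro ε hε
    simp [hε]

end IdempotentLifting

/-! ### Comparison of idempotent matrices over `𝒪` and over `A`. -/

section Density

open scoped Matrix.Norms.Operator in
theorem completeSpace_matrix (A : Type*) [NormedRing A] [CompleteSpace A] (n : ℕ) :
    @CompleteSpace (Matrix (Fin n) (Fin n) A) PseudoMetricSpace.toUniformSpace :=
  inferInstanceAs (CompleteSpace (Fin n → Fin n → A))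

open scoped Matrix.Norms.Operator in
theorem isOpen_isUnit_matrix (A : Type*) [NormedRing A] [CompleteSpace A] (n : ℕ) :
    IsOpen {x : Matrix (Fin n) (Fin n) A | IsUnit x} := by
  have := completeSpace_matrix A n
  have := Units.isOpen (R := Matrix (Fin n) (Fin n) A)
  exact this

/-- If `UV` and `VU` are invertible in the corners of the idempotents `p` and `q`, then `p` and `q`
are equivalent. -/
theorem mul_eq_of_inverse_corner {R : Type*} [Ring R] {n m : ℕ} {p : Matrix (Fin n) (Fin n) R}
    {q : Matrix (Fin m) (Fin m) R} {U : Matrix (Fin n) (Fin m) R} {V : Matrix (Fin m) (Fin n) R}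
    (hp : p * p = p) (hq : q * q = q) (hpU : p * U = U) (hUq : U * q = U) (hqV : q * V = V)
    (hVp : V * p = V) {c : Matrix (Fin n) (Fin n) R} {d : Matrix (Fin m) (Fin m) R}
    (hc₁ : (U * V + (1 - p)) * c = 1) (hc₂ : c * (U * V + (1 - p)) = 1)
    (hd : (V * U + (1 - q)) * d = 1) : U * (V * c) = p ∧ V * c * U = q := by
  have h₁ : p * (U * V + (1 - p)) = U * V := by
    rw [mul_add, mul_sub, hp, mul_one, sub_self, add_zero, ← Matrix.mul_assoc, hpU]
  have h₂ : (U * V + (1 - p)) * p = U * V := by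
    rw [add_mul, sub_mul, hp, one_mul, sub_self, add_zero, Matrix.mul_assoc, hVp]
  have h₃ : q * (V * U + (1 - q)) = V * U := by
    rw [mul_add, mul_sub, hq, mul_one, sub_self, add_zero, ← Matrix.mul_assoc, hqV]
  have h₄ : c * (U * V) = p := by rw [← h₂, ← mul_assoc, hc₂, one_mul]
  constructor
  · rw [← Matrix.mul_assoc, ← h₁, mul_assoc, hc₁, mul_one]
  · calc V * c * U = V * c * (U * q) * ((V * U + (1 - q)) * d) := by rw [hd, hUq, mul_one]
      _ = V * c * U * (q * (V * U + (1 - q))) * d := by simp only [Matrix.mul_assoc]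
      _ = V * (c * (U * V)) * U * d := by rw [h₃]; simp only [Matrix.mul_assoc]
      _ = q * ((V * U + (1 - q)) * d) := by rw [h₄, hVp, ← Matrix.mul_assoc, h₃]
      _ = q := by rw [hd, mul_one]

variable {A : Type*} [NormedRing A] [NormedAlgebra ℂ A] [StarRing A] [StarModule ℂ A]
  {𝒪 : StarSubalgebra ℂ A}

theorem dense_matrix_mem (h𝒪 : Dense (𝒪 : Set A)) (n m : ℕ) :
    Dense {x : Matrix (Fin n) (Fin m) A | ∀ i j, x i j ∈ 𝒪} := by
  have h : Dense (Set.univ.pi fun _ : Fin n => Set.univ.pi fun _ : Fin m => (𝒪 : Set A)) :=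
    dense_pi _ fun _ _ => dense_pi _ fun _ _ => h𝒪
  have hs : {x : Matrix (Fin n) (Fin m) A | ∀ i j, x i j ∈ 𝒪}
      = Set.univ.pi fun _ : Fin n => Set.univ.pi fun _ : Fin m => (𝒪 : Set A) :=
    Set.ext fun x => ⟨fun h i _ j _ => h i j, fun h i j => h i trivial j trivial⟩
  exact hs ▸ h

theorem exists_map_subtype_eq {n m : ℕ} {x : Matrix (Fin n) (Fin m) A}
    (hx : ∀ i j, x i j ∈ 𝒪) : ∃ x' : Matrix (Fin n) (Fin m) 𝒪, x'.map 𝒪.subtype.toRingHom = x :=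
  ⟨Matrix.of fun i j => ⟨x i j, hx i j⟩, rfl⟩

theorem map_subtype_injective {n m : ℕ} {x y : Matrix (Fin n) (Fin m) 𝒪}
    (h : x.map 𝒪.subtype.toRingHom = y.map 𝒪.subtype.toRingHom) : x = y :=
  Matrix.map_injective Subtype.val_injective h

theorem map_subtype_mul {n m l : ℕ} (x : Matrix (Fin n) (Fin m) 𝒪)
    (y : Matrix (Fin m) (Fin l) 𝒪) : (x * y).map 𝒪.subtype.toRingHom
      = x.map 𝒪.subtype.toRingHom * y.map 𝒪.subtype.toRingHom :=
  Matrix.map_mul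

open scoped Matrix.Norms.Operator in
theorem exists_inverse_of_isUnit_map (hst : StableUnderHolomorphicCalculus 𝒪) {n : ℕ}
    {c : Matrix (Fin n) (Fin n) 𝒪} (hc : IsUnit (c.map 𝒪.subtype.toRingHom)) :
    ∃ d : Matrix (Fin n) (Fin n) 𝒪, c * d = 1 ∧ d * c = 1 := by
  have hmem := inverse_mem_of_isHolomorphicCalculus
    (S := {x : Matrix (Fin n) (Fin n) A | ∀ i j, x i j ∈ 𝒪})
    (fun U f a b ha h => hst n U f a b ha h) (a := c.map 𝒪.subtype.toRingHom)
    (fun i j => (c i j).2) hc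
  obtain ⟨d, hd⟩ := exists_map_subtype_eq hmem
  have h1 : (1 : Matrix (Fin n) (Fin n) 𝒪).map 𝒪.subtype.toRingHom = 1 :=
    Matrix.map_one _ (map_zero _) (map_one _)
  refine ⟨d, map_subtype_injective ?_, map_subtype_injective ?_⟩
  · rw [map_subtype_mul, hd, h1, Ring.mul_inverse_cancel _ hc]
  · rw [map_subtype_mul, hd, h1, Ring.inverse_mul_cancel _ hc]

variable [CompleteSpace A]

open scoped Matrix.Norms.Operator in
/-- Every idempotent matrix over `A` is equivalent to one over `𝒪`. -/
theorem exists_equivalent_map (h𝒪 : Dense (𝒪 : Set A)) (hst : StableUnderHolomorphicCalculus 𝒪)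
    (e : IdemMatrix A) : ∃ b : IdemMatrix 𝒪, (b.map 𝒪.subtype.toRingHom).Equivalent e := by
  have := completeSpace_matrix A e.size
  obtain ⟨b, hbS, hbb, x, y, hxy, hyx⟩ := exists_idempotent_mem_of_dense
    (dense_matrix_mem h𝒪 e.size e.size) (fun U f a b ha h => hst e.size U f a b ha h) e.idem
  obtain ⟨b', rfl⟩ := exists_map_subtype_eq hbS
  exact ⟨⟨e.size, b', map_subtype_injective (by rw [map_subtype_mul, hbb])⟩, y, x, hyx, hxy⟩

/-- Idempotent matrices over `𝒪` that are equivalent over `A` are equivalent over `𝒪`. -/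
theorem equivalent_of_map_equivalent (h𝒪 : Dense (𝒪 : Set A))
    (hst : StableUnderHolomorphicCalculus 𝒪) {e f : IdemMatrix 𝒪}
    (h : (e.map 𝒪.subtype.toRingHom).Equivalent (f.map 𝒪.subtype.toRingHom)) :
    e.Equivalent f := by
  obtain ⟨n, p, hp⟩ := e
  obtain ⟨m, q, hq⟩ := f
  obtain ⟨x, y, hxy, hyx⟩ := h
  change Matrix (Fin n) (Fin m) A at x
  change Matrix (Fin m) (Fin n) A at y
  change x * y = p.map 𝒪.subtype.toRingHom at hxy
  change y * x = q.map 𝒪.subtype.toRingHom at hyx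
  -- Compress `x` and `y` to the corners of `p` and `q`. The complements added in `Φ` and `Ψ` turn
  -- invertibility in a corner into invertibility in the full matrix algebra.
  let U : Matrix (Fin n) (Fin m) A → Matrix (Fin n) (Fin m) A := fun x =>
    p.map 𝒪.subtype.toRingHom * x * q.map 𝒪.subtype.toRingHom
  let V : Matrix (Fin m) (Fin n) A → Matrix (Fin m) (Fin n) A := fun y =>
    q.map 𝒪.subtype.toRingHom * y * p.map 𝒪.subtype.toRingHom
  let Φ : Matrix (Fin n) (Fin m) A × Matrix (Fin m) (Fin n) A → Matrix (Fin n) (Fin n) A :=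
    fun z => U z.1 * V z.2 + (1 - p.map 𝒪.subtype.toRingHom)
  let Ψ : Matrix (Fin n) (Fin m) A × Matrix (Fin m) (Fin n) A → Matrix (Fin m) (Fin m) A :=
    fun z => V z.2 * U z.1 + (1 - q.map 𝒪.subtype.toRingHom)
  have hΦ : Continuous Φ := by fun_prop
  have hΨ : Continuous Ψ := by fun_prop
  have hopen := ((isOpen_isUnit_matrix A n).preimage hΦ).inter
    ((isOpen_isUnit_matrix A m).preimage hΨ)
  have hpp : p.map 𝒪.subtype.toRingHom * p.map 𝒪.subtype.toRingHom
      = p.map 𝒪.subtype.toRingHom := by rw [← map_subtype_mul, hp]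
  have hqq : q.map 𝒪.subtype.toRingHom * q.map 𝒪.subtype.toRingHom
      = q.map 𝒪.subtype.toRingHom := by rw [← map_subtype_mul, hq]
  have hΦ1 : Φ (x, y) = 1 := by
    have : U x * V y = p.map 𝒪.subtype.toRingHom := by
      simp only [U, V]
      rw [← hyx, ← hxy] at *
      calc x * y * x * (y * x) * (y * x * y * (x * y))
          = (x * y) * (x * y) * ((x * y) * (x * y)) * (x * y) := by simp only [Matrix.mul_assoc]
        _ = x * y := by rw [hpp, hpp, hpp]
    simp only [Φ, this, add_sub_cancel]
  have hΨ1 : Ψ (x, y) = 1 := by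
    have : V y * U x = q.map 𝒪.subtype.toRingHom := by
      simp only [U, V]
      rw [← hyx, ← hxy] at *
      calc y * x * y * (x * y) * (x * y * x * (y * x))
          = (y * x) * (y * x) * ((y * x) * (y * x)) * (y * x) := by simp only [Matrix.mul_assoc]
        _ = y * x := by rw [hqq, hqq, hqq]
    simp only [Ψ, this, add_sub_cancel]
  -- Both `Φ` and `Ψ` equal `1` at `(x, y)` and the units are open, so `(x, y)` can be moved to a
  -- pair with entries in `𝒪`. Inverses then stay over `𝒪` by stability.
  obtain ⟨⟨x', y'⟩, ⟨hu₁, hu₂⟩, hx', hy'⟩ :=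
    ((dense_matrix_mem h𝒪 n m).prod (dense_matrix_mem h𝒪 m n)).inter_open_nonempty _ hopen
      ⟨(x, y), by simp [hΦ1], by simp [hΨ1]⟩
  obtain ⟨u, rfl⟩ := exists_map_subtype_eq hx'
  obtain ⟨v, rfl⟩ := exists_map_subtype_eq hy'
  have hmap : ∀ {k : ℕ} (a b : Matrix (Fin k) (Fin k) 𝒪),
      (a + (1 - b)).map 𝒪.subtype.toRingHom
        = a.map 𝒪.subtype.toRingHom + (1 - b.map 𝒪.subtype.toRingHom) := fun {k} a b => by
    rw [← Matrix.map_one _ (map_zero 𝒪.subtype.toRingHom) (map_one _)]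
    rfl
  obtain ⟨c, hc₁, hc₂⟩ := exists_inverse_of_isUnit_map hst
    (c := (p * u * q) * (q * v * p) + (1 - p))
    (by rw [hmap]; simp only [map_subtype_mul]; exact hu₁)
  obtain ⟨d, hd₁, -⟩ := exists_inverse_of_isUnit_map hst
    (c := (q * v * p) * (p * u * q) + (1 - q))
    (by rw [hmap]; simp only [map_subtype_mul]; exact hu₂)
  exact ⟨p * u * q, q * v * p * c, mul_eq_of_inverse_corner hp hq
    (by rw [← Matrix.mul_assoc, ← Matrix.mul_assoc, hp]) (by rw [Matrix.mul_assoc, hq])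
    (by rw [← Matrix.mul_assoc, ← Matrix.mul_assoc, hq]) (by rw [Matrix.mul_assoc, hp])
    hc₁ hc₂ hd₁⟩

open scoped Matrix.Norms.Operator in
/-- The class in `K₀` is constant along continuous families of idempotent matrices. -/
theorem K0.cls_eq_of_continuous {A : Type*} [NormedRing A] [CompleteSpace A] {X : Type*}
    [TopologicalSpace X] [PreconnectedSpace X] {n : ℕ} {F : X → Matrix (Fin n) (Fin n) A}
    (hF : Continuous F) (hidem : ∀ x, F x * F x = F x) (x y : X) :
    K0.cls ⟨n, F x, hidem x⟩ = K0.cls ⟨n, F y, hidem y⟩ := by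
  have := completeSpace_matrix A n
  refine IsLocallyConstant.apply_eq_of_preconnectedSpace
    (f := fun x => K0.cls (⟨n, F x, hidem x⟩ : IdemMatrix A)) ?_ x y
  rw [IsLocallyConstant.iff_eventually_eq]
  intro x
  have hF' : Continuous fun y => ‖(2 * F x - 1) * (F y - F x)‖ :=
    ((hF.sub continuous_const).const_mul _).norm
  filter_upwards [(hF'.tendsto x).eventually_lt_const (u := 1) (by simp)] with y hy
  obtain ⟨a, b, hab, hba⟩ := exists_equivalent_of_norm_lt_one (hidem x) (hidem y) hy
  exact (K0.cls_eq_of_equivalent ⟨a, b, hab, hba⟩).symm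

/-- The entire extension of the one-parameter group connects an idempotent matrix `e` over `𝒪` with
`σ(e)` by idempotent matrices over `A`. -/
theorem OnePG.exists_path {τ : IsometricOneParameterGroup A} {σ : 𝒪 ≃ₐ[ℂ] 𝒪} (h : OnePG τ 𝒪 σ)
    (e : IdemMatrix 𝒪) : ∃ F : ℂ → Matrix (Fin e.size) (Fin e.size) A, Continuous F ∧
      (∀ z, F z * F z = F z) ∧ F 0 = e.mat.map 𝒪.subtype.toRingHom ∧
      F (-Complex.I) = (e.mat.map σ).map 𝒪.subtype.toRingHom := by
  choose F hF using fun i j => h.extension (e.mat i j)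
  refine ⟨fun z => Matrix.of fun i j => F i j z, ?_, fun z => ?_, ?_, ?_⟩
  · exact continuous_matrix fun i j => (hF i j).1.continuous
  · ext i j
    have hd : Differentiable ℂ fun z => ∑ k, F i k z * F k j z :=
      Differentiable.fun_sum fun k _ => (hF i k).1.mul (hF k j).1
    -- Idempotency holds at real `t` because each `τ_t` is an automorphism; the identity theorem
    -- extends it to all of `ℂ`, the points `1 / (k + 1)` accumulating at `0`.
    have heq : (fun z => ∑ k, F i k z * F k j z) = F i j := by
      refine AnalyticOnNhd.eq_of_frequently_eq (z₀ := 0) (𝕜 := ℂ)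
        (hd.differentiableOn.analyticOnNhd isOpen_univ)
        ((hF i j).1.differentiableOn.analyticOnNhd isOpen_univ) ?_
      have hreal : ∀ t : ℝ, ∑ k, F i k t * F k j t = F i j t := by
        intro t
        simp only [(hF _ _).2.1, ← map_mul, ← map_sum]
        congr 1
        have := congrFun₂ (congrArg (fun M => M.map 𝒪.subtype.toRingHom) e.idem) i j
        rwa [map_subtype_mul] at this
      have hlim : Tendsto (fun k : ℕ => ((1 / ((k : ℝ) + 1) : ℝ) : ℂ)) atTop (𝓝[≠] 0) := by
        refine tendsto_nhdsWithin_iff.2 ⟨?_, Eventually.of_forall fun k => ?_⟩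
        · exact Complex.ofReal_zero ▸ (Complex.continuous_ofReal.tendsto 0).comp
            tendsto_one_div_add_atTop_nhds_zero_nat
        · exact Complex.ofReal_ne_zero.2 (by positivity)
      exact hlim.frequently (Frequently.of_forall fun k => hreal _)
    exact congrFun heq z
  · ext i j
    have := (hF i j).2.1 0
    rw [τ.map_zero] at this
    simpa using this
  · ext i j
    exact (hF i j).2.2

variable [NormedStarGroup A]

/-- The classes of `σ(e)*` and `e*` in `K₀(A)` agree. -/
theorem OnePG.cls_adjoint_map_eq {τ : IsometricOneParameterGroup A} {σ : 𝒪 ≃ₐ[ℂ] 𝒪}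
    (h : OnePG τ 𝒪 σ) (e : IdemMatrix 𝒪) :
    K0.cls ((e.map (σ : 𝒪 →+* 𝒪)).adjoint.map 𝒪.subtype.toRingHom)
      = K0.cls (e.map 𝒪.subtype.toRingHom).adjoint := by
  obtain ⟨F, hF, hidem, h0, h1⟩ := h.exists_path e
  have hidem' : ∀ z, (F z).conjTranspose * (F z).conjTranspose = (F z).conjTranspose := fun z => by
    rw [← Matrix.conjTranspose_mul, hidem]
  -- The family `F(z)*` is no longer holomorphic in `z`, but continuity is all that is needed here.
  have := K0.cls_eq_of_continuous (F := fun z => (F z).conjTranspose)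
    hF.matrix_conjTranspose hidem' (-Complex.I) 0
  convert this using 2
  · simp only [IdemMatrix.map, IdemMatrix.adjoint, h1]
    rfl
  · simp only [IdemMatrix.map, IdemMatrix.adjoint, h0]

end Density

noncomputable section

/-! ### Matrices of operators. -/

section RectOp

variable {H : Type*} [NormedAddCommGroup H] [NormedSpace ℂ H] {ι κ μ : Type*} [Fintype κ]
  [Fintype μ]

/-- The operator `Hᵏ → Hⁱ` given by a rectangular matrix of operators. -/
def rectOp (M : Matrix ι κ (H →L[ℂ] H)) : (κ → H) →L[ℂ] (ι → H) :=
  ContinuousLinearMap.pi fun i => ∑ j, (M i j) ∘L (ContinuousLinearMap.proj j)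

theorem rectOp_apply (M : Matrix ι κ (H →L[ℂ] H)) (x : κ → H) (i : ι) :
    rectOp M x i = ∑ j, M i j (x j) := by
  simp [rectOp]

theorem rectOp_mul (M : Matrix ι κ (H →L[ℂ] H)) (N : Matrix κ μ (H →L[ℂ] H)) (x : μ → H) :
    rectOp (M * N) x = rectOp M (rectOp N x) := by
  ext i
  simp only [rectOp_apply, Matrix.mul_apply, sum_apply, map_sum,
    mul_apply_eq_comp]
  exact Finset.sum_comm

theorem rectOp_sub (M N : Matrix ι κ (H →L[ℂ] H)) : rectOp (M - N) = rectOp M - rectOp N := by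
  ext x i
  simp [rectOp_apply]

theorem rectOp_map_mul {𝒜 : Type*} [Ring 𝒜] (φ : 𝒜 →+* (H →L[ℂ] H)) (M : Matrix ι κ 𝒜)
    (N : Matrix κ μ 𝒜) (x : μ → H) :
    rectOp ((M * N).map φ) x = rectOp (M.map φ) (rectOp (N.map φ) x) := by
  rw [← rectOp_mul, Matrix.map_mul]

/-- Here `Hⁿ` carries the supremum norm and is not a Hilbert space, so approximation is done
entrywise and the entries are reassembled. -/
theorem rectOp_isApproximable [Fintype ι] [DecidableEq ι] {M : Matrix ι κ (H →L[ℂ] H)}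
    (hM : ∀ i j, (M i j).IsApproximable) : (rectOp M).IsApproximable := by
  have : rectOp M = ∑ i, ∑ j, ContinuousLinearMap.single ℂ (fun _ : ι => H) i ∘L
      ((M i j) ∘L (ContinuousLinearMap.proj j : (κ → H) →L[ℂ] H)) := by
    ext x k
    simp [rectOp_apply, Finset.sum_apply, Pi.single_apply]
  rw [this]
  exact .sum _ fun i _ => .sum _ fun j _ => ((hM i j).comp_right _).comp_left _

/-- Finite rank approximants of `K` need not map `U` into `W`; composing with the bounded retraction
`Q` onto `W` corrects this. -/
theorem ContinuousLinearMap.IsApproximable.of_coe {V V' : Type*} [NormedAddCommGroup V]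
    [NormedSpace ℂ V] [NormedAddCommGroup V'] [NormedSpace ℂ V'] {U : Submodule ℂ V}
    {W : Submodule ℂ V'} {u : U →L[ℂ] W} {K : V →L[ℂ] V'} (hK : K.IsApproximable)
    (Q : V' →L[ℂ] W) (hQ : ∀ w : W, Q w = w) (h : ∀ v : U, (u v : V') = K v) :
    u.IsApproximable := by
  have : u = Q ∘L (K ∘L U.subtypeL) := by
    ext v
    simp [← h, hQ]
  exact this ▸ (hK.comp_right _).comp_left Q

end RectOp

/-! ### The inverse of `D` and the representation `a ↦ D⁻¹ σ(a) D`. -/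

namespace GradedTwistedSpectralTriple

variable {H : Type*} [NormedAddCommGroup H] [InnerProductSpace ℂ H]
variable [CompleteSpace H] {𝒜 : Type*} [Ring 𝒜] [StarRing 𝒜] [Algebra ℂ 𝒜] [StarModule ℂ 𝒜]
  {σ : 𝒜 ≃ₐ[ℂ] 𝒜} (T : GradedTwistedSpectralTriple H 𝒜 σ)

theorem γ_γ (x : H) : T.γ (T.γ x) = x :=
  congrArg (fun S : H →L[ℂ] H => S x) T.γ_sq

theorem γ_mem (x : T.D.domain) : T.γ x ∈ T.D.domain := (T.γ_anticomm x).1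

theorem D_γ (x : T.D.domain) : T.D ⟨T.γ x, T.γ_mem x⟩ = -T.γ (T.D x) := (T.γ_anticomm x).2

theorem π_mem (a : 𝒜) (x : T.D.domain) : T.π a x ∈ T.D.domain := (T.bounded a).1 x

theorem ext_on_domain {S S' : H →L[ℂ] H} (h : ∀ x : T.D.domain, S x = S' x) : S = S' :=
  DFunLike.coe_injective (Continuous.ext_on T.selfAdjoint.dense_domain S.continuous S'.continuous
    fun x hx => h ⟨x, hx⟩)

/-- A homomorphism from `𝒜` to the operators commuting with the grading. -/
def IsEven (φ : 𝒜 →+* (H →L[ℂ] H)) : Prop :=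
  ∀ a x, T.γ (φ a x) = φ a (T.γ x)

/-- The representation of `𝒜`, as a ring homomorphism. -/
def rep : 𝒜 →+* (H →L[ℂ] H) := RingHomClass.toRingHom T.π

theorem rep_apply (a : 𝒜) : T.rep a = T.π a := rfl

theorem rep_isEven : T.IsEven T.rep :=
  fun a x => congrArg (fun S : H →L[ℂ] H => S x) (T.γ_comm a)

variable (hD : T.Invertible)

theorem Dinv_mem (x : H) : T.Dinv hD x ∈ T.D.domain := (hD.choose_spec.1 x).1

theorem D_Dinv (x : H) : T.D ⟨T.Dinv hD x, T.Dinv_mem hD x⟩ = x := by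
  obtain ⟨_, h⟩ := hD.choose_spec.1 x
  rw [zero_smul, sub_zero] at h
  exact h

/-- Resolvent identity: `D⁻¹ = R - z D⁻¹ R`, with `R` the compact resolvent at `z`. -/
theorem Dinv_isCompactOperator : IsCompactOperator (T.Dinv hD) := by
  obtain ⟨z, R, ⟨hR, -⟩, hc⟩ := T.compactResolvent
  have : T.Dinv hD = R - z • (T.Dinv hD ∘L R) := by
    ext x
    obtain ⟨hx, hx'⟩ := hR x
    have := congrArg (T.Dinv hD) hx'
    rw [map_sub, map_smul, T.Dinv_apply_D] at this
    simpa using this.symm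
  rw [this]
  exact hc.sub ((hc.clm_comp (T.Dinv hD)).smul z)

theorem γ_Dinv (x : H) : T.γ (T.Dinv hD x) = -T.Dinv hD (T.γ x) := by
  have h := T.D_γ ⟨T.Dinv hD x, T.Dinv_mem hD x⟩
  rw [T.D_Dinv hD] at h
  have h' := congrArg (T.Dinv hD) h
  rwa [T.Dinv_apply_D, map_neg] at h'

theorem twistedConj_apply (a : 𝒜) (x : T.D.domain) :
    T.twistedConj hD a x = T.Dinv hD (T.π (σ a) (T.D x)) :=
  (T.exists_twistedConj hD a).choose_spec x

theorem twistedConj_mem (a : 𝒜) (x : T.D.domain) : T.twistedConj hD a x ∈ T.D.domain :=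
  T.twistedConj_apply hD a x ▸ T.Dinv_mem hD _

theorem D_twistedConj (a : 𝒜) (x : T.D.domain) :
    T.D ⟨T.twistedConj hD a x, T.twistedConj_mem hD a x⟩ = T.π (σ a) (T.D x) := by
  rw [← T.D_Dinv hD (T.π (σ a) (T.D x))]
  congr 1
  exact Subtype.ext (T.twistedConj_apply hD a x)

/-- The homomorphism `a ↦ D⁻¹ σ(a) D`. -/
def twistedRep : 𝒜 →+* (H →L[ℂ] H) where
  toFun := T.twistedConj hD
  map_one' := T.ext_on_domain fun x => by
    simp [twistedConj_apply, Dinv_apply_D]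
  map_zero' := T.ext_on_domain fun x => by
    simp [twistedConj_apply]
  map_add' a b := T.ext_on_domain fun x => by
    simp [twistedConj_apply]
  map_mul' a b := T.ext_on_domain fun x => by
    have := T.twistedConj_apply hD a ⟨_, T.twistedConj_mem hD b x⟩
    rw [D_twistedConj] at this
    rw [mul_apply_eq_comp, this, twistedConj_apply]
    simp

theorem twistedRep_isEven : T.IsEven (T.twistedRep hD) := by
  intro a x
  have : T.γ ∘L T.twistedConj hD a = T.twistedConj hD a ∘L T.γ := by
    refine T.ext_on_domain fun x => ?_
    have h := T.twistedConj_apply hD a ⟨_, T.γ_mem x⟩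
    rw [D_γ] at h
    have hc := T.rep_isEven (σ a) (T.D x)
    rw [rep_apply] at hc
    rw [ContinuousLinearMap.comp_apply, ContinuousLinearMap.comp_apply, h, twistedConj_apply,
      γ_Dinv, hc, map_neg, map_neg]
  exact congrArg (fun S : H →L[ℂ] H => S x) this

/-- `a - D⁻¹ σ(a) D = D⁻¹ (D a - σ(a) D)`, with `D a - σ(a) D` bounded. -/
theorem exists_rep_sub_twistedRep (a : 𝒜) :
    ∃ G : H →L[ℂ] H, T.rep a - T.twistedRep hD a = T.Dinv hD ∘L G := by
  obtain ⟨hdom, C, hC⟩ := T.bounded a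
  let D' : T.D.domain →ₗ[ℂ] H :=
    T.D.toFun ∘ₗ ((T.π a).toLinearMap ∘ₗ T.D.domain.subtype).codRestrict T.D.domain hdom
      - (T.π (σ a)).toLinearMap ∘ₗ T.D.toFun
  let G := (D'.mkContinuous C hC).extend (Submodule.subtypeL T.D.domain)
  have hG : ∀ x : T.D.domain, G x = T.D ⟨T.π a x, hdom x⟩ - T.π (σ a) (T.D x) := fun x =>
    ContinuousLinearMap.extend_eq _ T.selfAdjoint.dense_domain.denseRange_val
      isUniformEmbedding_subtype_val.isUniformInducing x
  refine ⟨G, T.ext_on_domain fun x => ?_⟩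
  rw [ContinuousLinearMap.comp_apply, hG, map_sub, Dinv_apply_D, ← twistedConj_apply]
  rfl

theorem rep_sub_twistedRep_isApproximable (a : 𝒜) :
    (T.rep a - T.twistedRep hD a).IsApproximable := by
  obtain ⟨G, hG⟩ := T.exists_rep_sub_twistedRep hD a
  rw [hG]
  exact (ContinuousLinearMap.IsApproximable.of_isCompactOperator
    (T.Dinv_isCompactOperator hD)).comp_right G

/-- This regularity places the kernels of the index operators in the domain of `D`, where the
pairing `⟨D y, x⟩` is defined. -/
theorem rep_sub_twistedRep_mem (a : 𝒜) (x : H) :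
    T.rep a x - T.twistedRep hD a x ∈ T.D.domain := by
  obtain ⟨G, hG⟩ := T.exists_rep_sub_twistedRep hD a
  rw [← sub_apply, hG]
  exact T.Dinv_mem hD _

end GradedTwistedSpectralTriple

end

/-! ### Index of the operators between ranges of idempotents. -/

noncomputable section

theorem rectOp_map_sub_isApproximable {H : Type*} [NormedAddCommGroup H] [NormedSpace ℂ H]
    {𝒜 : Type*} [Ring 𝒜] {φ ψ : 𝒜 →+* (H →L[ℂ] H)} (hφψ : ∀ a, (φ a - ψ a).IsApproximable) {n m : ℕ}
    (M : Matrix (Fin n) (Fin m) 𝒜) :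
    (rectOp (M.map φ) - rectOp (M.map ψ)).IsApproximable := by
  rw [← rectOp_sub]
  exact rectOp_isApproximable fun i j => hφψ (M i j)

/-- Concatenation of vectors. -/
def appendEquiv (H : Type*) [AddCommGroup H] [Module ℂ H] {𝒜 : Type*} [Ring 𝒜]
    (e f : IdemMatrix 𝒜) :
    ((Fin e.size → H) × (Fin f.size → H)) ≃ₗ[ℂ] (Fin (e.blockSum f).size → H) :=
  (LinearEquiv.sumArrowLequivProdArrow (Fin e.size) (Fin f.size) ℂ H).symm.trans
    (LinearEquiv.funCongrLeft ℂ H (finSumFinEquiv (m := e.size) (n := f.size)).symm)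

/-- The index set of a block sum. -/
def blockSumEquiv {𝒜 : Type*} [Ring 𝒜] (e f : IdemMatrix 𝒜) :
    Fin e.size ⊕ Fin f.size ≃ Fin (e.blockSum f).size :=
  finSumFinEquiv

theorem appendEquiv_apply {H : Type*} [AddCommGroup H] [Module ℂ H] {𝒜 : Type*} [Ring 𝒜]
    {e f : IdemMatrix 𝒜} (p : (Fin e.size → H) × (Fin f.size → H)) (i : Fin e.size ⊕ Fin f.size) :
    appendEquiv H e f p (blockSumEquiv e f i) = Sum.elim p.1 p.2 i := by
  have : appendEquiv H e f p (blockSumEquiv e f i)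
      = Sum.elim p.1 p.2 (finSumFinEquiv.symm (finSumFinEquiv i)) := by
    cases i <;> rfl
  rw [this, Equiv.symm_apply_apply]

theorem blockSum_mat_apply {𝒜 : Type*} [Ring 𝒜] (e f : IdemMatrix 𝒜)
    (i j : Fin e.size ⊕ Fin f.size) :
    (e.blockSum f).mat (blockSumEquiv e f i) (blockSumEquiv e f j)
      = Matrix.fromBlocks e.mat 0 0 f.mat i j := by
  have : (e.blockSum f).mat (blockSumEquiv e f i) (blockSumEquiv e f j)
      = Matrix.fromBlocks e.mat 0 0 f.mat (finSumFinEquiv.symm (finSumFinEquiv i))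
        (finSumFinEquiv.symm (finSumFinEquiv j)) := rfl
  rw [this, Equiv.symm_apply_apply, Equiv.symm_apply_apply]

theorem rectOp_blockSum {H : Type*} [NormedAddCommGroup H] [NormedSpace ℂ H]
    {𝒜 : Type*} [Ring 𝒜] (e f : IdemMatrix 𝒜) (φ : 𝒜 →+* (H →L[ℂ] H))
    (p : (Fin e.size → H) × (Fin f.size → H)) :
    rectOp ((e.blockSum f).mat.map φ) (appendEquiv H e f p)
      = appendEquiv H e f (rectOp (e.mat.map φ) p.1, rectOp (f.mat.map φ) p.2) := by
  have h : ∀ i, rectOp ((e.blockSum f).mat.map φ) (appendEquiv H e f p)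
      (blockSumEquiv e f i) = Sum.elim (rectOp (e.mat.map φ) p.1) (rectOp (f.mat.map φ) p.2) i := by
    intro i
    rw [rectOp_apply]
    refine (Equiv.sum_comp (blockSumEquiv e f) _).symm.trans ?_
    simp only [appendEquiv_apply, Matrix.map_apply, blockSum_mat_apply]
    cases i <;> simp [Fintype.sum_sum_type, rectOp_apply]
  ext k
  obtain ⟨i, rfl⟩ := (blockSumEquiv e f).surjective k
  rw [appendEquiv_apply]
  exact h i

namespace GradedTwistedSpectralTriple

variable {H : Type*} [NormedAddCommGroup H] [InnerProductSpace ℂ H]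
variable [CompleteSpace H] {𝒜 : Type*} [Ring 𝒜] [StarRing 𝒜] [Algebra ℂ 𝒜] [StarModule ℂ 𝒜]
  {σ : 𝒜 ≃ₐ[ℂ] 𝒜} (T : GradedTwistedSpectralTriple H 𝒜 σ)

theorem mem_gradedPart {s : ℤˣ} {n : ℕ} {x : Fin n → H} :
    x ∈ T.gradedPart s n ↔ ∀ i, T.γ (x i) = (s : ℤ) • x i := Iff.rfl

theorem rectOp_mem_gradedPart {φ : 𝒜 →+* (H →L[ℂ] H)} (hφ : T.IsEven φ) (s : ℤˣ) {n m : ℕ}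
    (M : Matrix (Fin m) (Fin n) 𝒜) {x : Fin n → H} (hx : x ∈ T.gradedPart s n) :
    rectOp (M.map φ) x ∈ T.gradedPart s m := by
  intro i
  simp only [rectOp_apply, Matrix.map_apply, map_sum, hφ _ _, Finset.smul_sum]
  exact Finset.sum_congr rfl fun j _ => by rw [hx j, map_zsmul]

/-- The projection onto `H₊ⁿ` or `H₋ⁿ`. -/
def gradedProj (s : ℤˣ) (n : ℕ) : (Fin n → H) →L[ℂ] (Fin n → H) :=
  ContinuousLinearMap.pi fun i => ((1 / 2 : ℂ) • (ContinuousLinearMap.id ℂ H + (s : ℤ) • T.γ)) ∘L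
    ContinuousLinearMap.proj i

theorem gradedProj_apply (s : ℤˣ) (n : ℕ) (x : Fin n → H) (i : Fin n) :
    T.gradedProj s n x i = (1 / 2 : ℂ) • (x i + (s : ℤ) • T.γ (x i)) := rfl

theorem gradedProj_mem (s : ℤˣ) (n : ℕ) (x : Fin n → H) :
    T.gradedProj s n x ∈ T.gradedPart s n := by
  intro i
  rw [gradedProj_apply, map_smul, map_add, map_zsmul, γ_γ, smul_comm (s : ℤ), smul_add (s : ℤ),
    smul_smul (s : ℤ), ← Units.val_mul, Int.units_mul_self, Units.val_one, one_smul, add_comm]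

theorem gradedProj_eq_self {s : ℤˣ} {n : ℕ} {x : Fin n → H} (hx : x ∈ T.gradedPart s n) :
    T.gradedProj s n x = x := by
  ext i
  rw [gradedProj_apply, hx i, smul_smul (s : ℤ), ← Units.val_mul, Int.units_mul_self,
    Units.val_one, one_smul, ← two_smul ℂ, smul_smul]
  norm_num

/-- The range of the idempotent `e` on `H₊ⁿ` or `H₋ⁿ`, in a given representation. -/
def gradedRange (s : ℤˣ) (φ : 𝒜 →+* (H →L[ℂ] H)) (e : IdemMatrix 𝒜) :
    Submodule ℂ (Fin e.size → H) :=
  (T.gradedPart s e.size).map (rectOp (e.mat.map φ)).toLinearMap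

variable {φ ψ : 𝒜 →+* (H →L[ℂ] H)} (hφ : T.IsEven φ) (hψ : T.IsEven ψ)

include hφ in
theorem mem_gradedRange {s : ℤˣ} {e : IdemMatrix 𝒜} {x : Fin e.size → H} :
    x ∈ T.gradedRange s φ e ↔ x ∈ T.gradedPart s e.size ∧ rectOp (e.mat.map φ) x = x := by
  constructor
  · rintro ⟨y, hy, rfl⟩
    refine ⟨T.rectOp_mem_gradedPart hφ s e.mat hy, ?_⟩
    change rectOp (e.mat.map φ) (rectOp (e.mat.map φ) y) = rectOp (e.mat.map φ) y
    rw [← rectOp_map_mul, e.idem]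
  · rintro ⟨hx, h⟩
    exact ⟨x, hx, h⟩

/-- The projection onto the range of `e` on `H₊ⁿ` or `H₋ⁿ`. -/
def gradedRangeProj (s : ℤˣ) (φ : 𝒜 →+* (H →L[ℂ] H)) (e : IdemMatrix 𝒜) :
    (Fin e.size → H) →L[ℂ] T.gradedRange s φ e :=
  (rectOp (e.mat.map φ) ∘L T.gradedProj s e.size).codRestrict _
    fun x => ⟨_, T.gradedProj_mem s e.size x, rfl⟩

include hφ in
theorem gradedRangeProj_eq_self {s : ℤˣ} {e : IdemMatrix 𝒜} (x : T.gradedRange s φ e) :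
    T.gradedRangeProj s φ e x = x := by
  obtain ⟨h₁, h₂⟩ := (T.mem_gradedRange hφ).1 x.2
  refine Subtype.ext ?_
  change rectOp (e.mat.map φ) (T.gradedProj s e.size x) = x
  rw [T.gradedProj_eq_self h₁, h₂]

-- The range is the fixed point set of a bounded projection, hence closed; completeness is needed
-- for the Fredholm theory.
include hφ in
theorem completeSpace_gradedRange (s : ℤˣ) (e : IdemMatrix 𝒜) :
    CompleteSpace (T.gradedRange s φ e) := by
  have hcl : IsClosed (T.gradedRange s φ e : Set (Fin e.size → H)) := by
    have : (T.gradedRange s φ e : Set (Fin e.size → H))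
        = {x | (T.gradedRangeProj s φ e x : Fin e.size → H) = x} := by
      ext x
      refine ⟨fun hx => congrArg Subtype.val (T.gradedRangeProj_eq_self hφ ⟨x, hx⟩), fun hx => ?_⟩
      have hx' : (T.gradedRangeProj s φ e x : Fin e.size → H) = x := hx
      exact hx' ▸ (T.gradedRangeProj s φ e x).2
    rw [this]
    exact isClosed_eq (by fun_prop) continuous_id
  exact hcl.completeSpace_coe

/-- The operator from the range of `e` to the range of `f` given by a matrix `M` over `𝒜`. -/
def transfer (s : ℤˣ) (φ : 𝒜 →+* (H →L[ℂ] H)) (hψ : T.IsEven ψ) (e f : IdemMatrix 𝒜)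
    (hφ : T.IsEven φ) (M : Matrix (Fin f.size) (Fin e.size) 𝒜) :
    T.gradedRange s φ e →L[ℂ] T.gradedRange s ψ f :=
  (rectOp ((f.mat * M).map ψ)).restrict fun x hx =>
    ⟨_, T.rectOp_mem_gradedPart hψ s M ((T.mem_gradedRange hφ).1 hx).1,
      (rectOp_map_mul ψ f.mat M x).symm⟩

theorem coe_transfer (s : ℤˣ) (e f : IdemMatrix 𝒜) (M : Matrix (Fin f.size) (Fin e.size) 𝒜)
    (x : T.gradedRange s φ e) : (T.transfer s φ hψ e f hφ M x : Fin f.size → H)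
      = rectOp ((f.mat * M).map ψ) x := rfl

/-- If two representations agree modulo approximable operators, then the operators between the
ranges of `e` in them given by `e` are inverse to each other modulo approximable operators. -/
theorem transfer_isEssInverse (hφψ : ∀ a, (φ a - ψ a).IsApproximable) (s : ℤˣ)
    (e : IdemMatrix 𝒜) : (T.transfer s φ hψ e e hφ 1).IsEssInverse
      (T.transfer s ψ hφ e e hψ 1) := by
  have key : ∀ {φ ψ : 𝒜 →+* (H →L[ℂ] H)} (hφ : T.IsEven φ) (hψ : T.IsEven ψ),
      (∀ a, (φ a - ψ a).IsApproximable) → (T.transfer s ψ hφ e e hψ 1 ∘L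
        T.transfer s φ hψ e e hφ 1 - ContinuousLinearMap.id ℂ _).IsApproximable := by
    intro φ ψ hφ hψ hφψ
    -- On the range of `φ(e)` one has `φ(e) ψ(e) x - x = -φ(e) (φ(e) - ψ(e)) x`.
    refine ((rectOp_map_sub_isApproximable hφψ e.mat).neg.comp_left
      (rectOp (e.mat.map φ))).of_coe (T.gradedRangeProj s φ e)
      (T.gradedRangeProj_eq_self hφ) fun x => ?_
    have hx := ((T.mem_gradedRange hφ).1 x.2).2
    simp only [sub_apply, ContinuousLinearMap.comp_apply, ContinuousLinearMap.id_apply,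
      AddSubgroupClass.coe_sub, coe_transfer, mul_one, neg_sub, map_sub, hx]
  exact ⟨key hφ hψ hφψ, key hψ hφ fun a => by
    rw [← neg_sub]
    exact (hφψ a).neg⟩

theorem transfer_transfer_eq {s : ℤˣ} {e f : IdemMatrix 𝒜}
    {M : Matrix (Fin f.size) (Fin e.size) 𝒜} {N : Matrix (Fin e.size) (Fin f.size) 𝒜}
    (hNM : N * (f.mat * M) = e.mat) (x : T.gradedRange s φ e) :
    T.transfer s φ hφ f e hφ N (T.transfer s φ hφ e f hφ M x) = x := by
  refine Subtype.ext ?_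
  rw [coe_transfer, coe_transfer, ← rectOp_map_mul, Matrix.mul_assoc, hNM, e.idem]
  exact ((T.mem_gradedRange hφ).1 x.2).2

/-- Equivalent idempotents have isomorphic ranges. -/
def transferEquiv (s : ℤˣ) (e f : IdemMatrix 𝒜) (hφ : T.IsEven φ)
    (M : Matrix (Fin f.size) (Fin e.size) 𝒜) (N : Matrix (Fin e.size) (Fin f.size) 𝒜)
    (hNM : N * (f.mat * M) = e.mat) (hMN : M * (e.mat * N) = f.mat) :
    T.gradedRange s φ e ≃ₗ[ℂ] T.gradedRange s φ f where
  __ := (T.transfer s φ hφ e f hφ M).toLinearMap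
  invFun := T.transfer s φ hφ f e hφ N
  left_inv := T.transfer_transfer_eq hφ hNM
  right_inv := T.transfer_transfer_eq hφ hMN

/-- Carrying the operator of `e` to the ranges of `f` gives `ψ(f y) ψ(e) φ(e x)`. Replacing `φ` by
`ψ` costs an approximable operator and leaves `ψ(f)`, the operator of `f`. -/
theorem transfer_index_eq_of_equivalent (hφψ : ∀ a, (φ a - ψ a).IsApproximable) (s : ℤˣ)
    {e f : IdemMatrix 𝒜} (h : e.Equivalent f) :
    (T.transfer s φ hψ e e hφ 1).toLinearMap.index
      = (T.transfer s φ hψ f f hφ 1).toLinearMap.index := by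
  have := T.completeSpace_gradedRange hφ s f
  have := T.completeSpace_gradedRange hψ s f
  obtain ⟨x, y, hxy, hyx⟩ := h
  have h₁ : x * (f.mat * y) = e.mat := by
    rw [← hyx, Matrix.mul_assoc, ← Matrix.mul_assoc, ← Matrix.mul_assoc, hxy,
      Matrix.mul_assoc, hxy, e.idem]
  have h₂ : y * (e.mat * x) = f.mat := by
    rw [← hxy, Matrix.mul_assoc, ← Matrix.mul_assoc, ← Matrix.mul_assoc, hyx,
      Matrix.mul_assoc, hyx, f.idem]
  let g : T.gradedRange s φ f →L[ℂ] T.gradedRange s ψ f :=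
    T.transfer s ψ hψ e f hψ y ∘L T.transfer s φ hψ e e hφ 1 ∘L T.transfer s φ hφ f e hφ x
  have hg : (T.transfer s φ hψ e e hφ 1).toLinearMap.index = g.toLinearMap.index := by
    refine LinearMap.index_eq_of_equiv (T.transferEquiv s f e hφ x y h₂ h₁)
      (T.transferEquiv s f e hψ x y h₂ h₁) fun w => ?_
    exact T.transfer_transfer_eq hψ h₁ _
  rw [hg]
  refine (T.transfer_isEssInverse hφ hψ hφψ s f).index_congr ?_
  refine ((rectOp_map_sub_isApproximable hφψ (e.mat * x)).comp_left
      (rectOp ((f.mat * y).map ψ) ∘L rectOp (e.mat.map ψ))).of_coe (T.gradedRangeProj s ψ f)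
      (T.gradedRangeProj_eq_self hψ) fun w => ?_
  have e₁ : f.mat * y * (e.mat * (e.mat * x)) = f.mat := by
    rw [← Matrix.mul_assoc e.mat, e.idem, Matrix.mul_assoc, h₂, f.idem]
  have e₂ : rectOp ((f.mat * y).map ψ) (rectOp (e.mat.map ψ) (rectOp ((e.mat * x).map ψ) w))
      = rectOp (f.mat.map ψ) (w : Fin f.size → H) := by
    rw [← rectOp_map_mul, ← rectOp_map_mul, Matrix.mul_assoc, e₁]
  simp only [g, sub_apply, ContinuousLinearMap.comp_apply, AddSubgroupClass.coe_sub, coe_transfer,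
    mul_one, map_sub, e₂]

include hφ in
theorem appendEquiv_mem_gradedRange {s : ℤˣ} {e f : IdemMatrix 𝒜}
    {p : (Fin e.size → H) × (Fin f.size → H)} :
    appendEquiv H e f p ∈ T.gradedRange s φ (e.blockSum f)
      ↔ p.1 ∈ T.gradedRange s φ e ∧ p.2 ∈ T.gradedRange s φ f := by
  have hg : appendEquiv H e f p ∈ T.gradedPart s (e.blockSum f).size
      ↔ p.1 ∈ T.gradedPart s e.size ∧ p.2 ∈ T.gradedPart s f.size := by
    simp only [mem_gradedPart]
    refine ((blockSumEquiv e f).forall_congr_right (q := fun k =>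
      T.γ (appendEquiv H e f p k) = (s : ℤ) • appendEquiv H e f p k)).symm.trans
      ?_
    simp only [appendEquiv_apply, Sum.forall, Sum.elim_inl, Sum.elim_inr]
  rw [T.mem_gradedRange hφ, T.mem_gradedRange hφ, T.mem_gradedRange hφ, hg, rectOp_blockSum,
    (appendEquiv H e f).injective.eq_iff, Prod.ext_iff]
  tauto

/-- The range of a block sum. -/
def gradedRangeBlockSumEquiv (s : ℤˣ) (hφ : T.IsEven φ) (e f : IdemMatrix 𝒜) :
    (T.gradedRange s φ e × T.gradedRange s φ f) ≃ₗ[ℂ] T.gradedRange s φ (e.blockSum f) :=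
  LinearEquiv.ofBijective
    (((appendEquiv H e f).toLinearMap ∘ₗ ((T.gradedRange s φ e).subtype.prodMap
      (T.gradedRange s φ f).subtype)).codRestrict (T.gradedRange s φ (e.blockSum f))
        fun p => (T.appendEquiv_mem_gradedRange hφ).2 ⟨p.1.2, p.2.2⟩) <| by
    refine ⟨fun p q h => ?_, fun x => ?_⟩
    · have h' := (appendEquiv H e f).injective (congrArg Subtype.val h)
      exact Prod.ext (Subtype.ext (congrArg Prod.fst h')) (Subtype.ext (congrArg Prod.snd h'))
    · obtain ⟨p, hp⟩ := (appendEquiv H e f).surjective x.1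
      obtain ⟨h₁, h₂⟩ := (T.appendEquiv_mem_gradedRange hφ).1 (hp ▸ x.2)
      exact ⟨(⟨p.1, h₁⟩, ⟨p.2, h₂⟩), Subtype.ext hp⟩

theorem coe_gradedRangeBlockSumEquiv (s : ℤˣ) (e f : IdemMatrix 𝒜)
    (p : T.gradedRange s φ e × T.gradedRange s φ f) :
    (T.gradedRangeBlockSumEquiv s hφ e f p : Fin (e.blockSum f).size → H)
      = appendEquiv H e f (p.1, p.2) := rfl

theorem transfer_index_blockSum (hφψ : ∀ a, (φ a - ψ a).IsApproximable) (s : ℤˣ)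
    (e f : IdemMatrix 𝒜) :
    (T.transfer s φ hψ (e.blockSum f) (e.blockSum f) hφ 1).toLinearMap.index
      = (T.transfer s φ hψ e e hφ 1).toLinearMap.index
        + (T.transfer s φ hψ f f hφ 1).toLinearMap.index := by
  have := T.completeSpace_gradedRange hφ s
  have := T.completeSpace_gradedRange hψ s
  have he := (T.transfer_isEssInverse hφ hψ hφψ s e).isFredholm
  have hf := (T.transfer_isEssInverse hφ hψ hφψ s f).isFredholm
  have := he.finiteDimensional_ker
  have := he.finiteDimensional_coker
  have := hf.finiteDimensional_ker
  have := hf.finiteDimensional_coker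
  rw [← LinearMap.index_prodMap]
  refine LinearMap.index_eq_of_equiv (T.gradedRangeBlockSumEquiv s hφ e f)
    (T.gradedRangeBlockSumEquiv s hψ e f) fun p => Subtype.ext ?_
  rw [coe_gradedRangeBlockSumEquiv, ContinuousLinearMap.coe_coe, coe_transfer,
    coe_gradedRangeBlockSumEquiv, mul_one, rectOp_blockSum, LinearMap.prodMap_apply,
    ContinuousLinearMap.coe_coe, ContinuousLinearMap.coe_coe, coe_transfer, coe_transfer, mul_one,
    mul_one]

variable (hD : T.Invertible)

theorem indexOp_eq_transfer (s : ℤˣ) (e : IdemMatrix 𝒜) :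
    T.indexOp hD s e
      = T.transfer s T.rep (T.twistedRep_isEven hD) e e T.rep_isEven 1 := by
  ext x : 2
  -- On square matrices `rectOp` and `matOp` are the same by definition.
  refine Eq.trans ?_ (T.coe_transfer T.rep_isEven (T.twistedRep_isEven hD) s e e 1 x).symm
  rw [mul_one]
  rfl

theorem indexOp_isFredholm (s : ℤˣ) (e : IdemMatrix 𝒜) : (T.indexOp hD s e).IsFredholm := by
  have := T.completeSpace_gradedRange T.rep_isEven s e
  have := T.completeSpace_gradedRange (T.twistedRep_isEven hD) s e
  rw [indexOp_eq_transfer]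
  exact (T.transfer_isEssInverse _ _ (T.rep_sub_twistedRep_isApproximable hD) s e).isFredholm

theorem indexOp_index (s : ℤˣ) (e : IdemMatrix 𝒜) :
    (T.indexOp hD s e).toLinearMap.index
      = (T.transfer s T.rep (T.twistedRep_isEven hD) e e T.rep_isEven 1).toLinearMap.index :=
  congrArg (fun u : T.gradedRange s T.rep e →L[ℂ] T.gradedRange s (T.twistedRep hD) e =>
    u.toLinearMap.index) (T.indexOp_eq_transfer hD s e)

theorem indexOp_index_eq_of_equivalent (s : ℤˣ) {e f : IdemMatrix 𝒜} (h : e.Equivalent f) :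
    (T.indexOp hD s e).toLinearMap.index = (T.indexOp hD s f).toLinearMap.index := by
  rw [indexOp_index, indexOp_index]
  exact T.transfer_index_eq_of_equivalent _ _ (T.rep_sub_twistedRep_isApproximable hD) s h

theorem indexOp_index_blockSum (s : ℤˣ) (e f : IdemMatrix 𝒜) :
    (T.indexOp hD s (e.blockSum f)).toLinearMap.index
      = (T.indexOp hD s e).toLinearMap.index + (T.indexOp hD s f).toLinearMap.index := by
  rw [indexOp_index, indexOp_index, indexOp_index]
  exact T.transfer_index_blockSum _ _ (T.rep_sub_twistedRep_isApproximable hD) s e f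

end GradedTwistedSpectralTriple

end

noncomputable section

/-! ### Duality between opposite gradings. -/

namespace GradedTwistedSpectralTriple

variable {H : Type*} [NormedAddCommGroup H] [InnerProductSpace ℂ H]
variable [CompleteSpace H] {𝒜 : Type*} [Ring 𝒜] [StarRing 𝒜] [Algebra ℂ 𝒜] [StarModule ℂ 𝒜]
  {σ : 𝒜 ≃ₐ[ℂ] 𝒜} (T : GradedTwistedSpectralTriple H 𝒜 σ)

theorem inner_D_left (x y : T.D.domain) : inner ℂ (T.D x) (y : H) = inner ℂ (x : H) (T.D y) := by
  have h := LinearPMap.adjoint_isFormalAdjoint T.selfAdjoint.dense_domain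
  rw [LinearPMap.isSelfAdjoint_def.1 T.selfAdjoint] at h
  exact h x y

theorem inner_π_left (a : 𝒜) (x y : H) : inner ℂ (T.π (star a) x) y = inner ℂ x (T.π a y) := by
  rw [map_star, ContinuousLinearMap.star_eq_adjoint, ContinuousLinearMap.adjoint_inner_left]

/-- Two representations that preserve the domain of `D`, agree modulo operators into this domain,
and are adjoint to each other, up to the twist, for the pairing `⟨D y, x⟩`. -/
structure IsDualPair (φ ψ : 𝒜 →+* (H →L[ℂ] H)) : Prop where
  mem_left : ∀ a (y : T.D.domain), φ a y ∈ T.D.domain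
  mem_right : ∀ a (y : T.D.domain), ψ a y ∈ T.D.domain
  sub_mem : ∀ a x, φ a x - ψ a x ∈ T.D.domain
  inner_left : ∀ a (y : T.D.domain) x, inner ℂ (T.D y) (φ a x)
    = inner ℂ (T.D ⟨ψ (star (σ a)) y, mem_right _ y⟩) x
  inner_right : ∀ a (y : T.D.domain) x, inner ℂ (T.D y) (ψ a x)
    = inner ℂ (T.D ⟨φ (star (σ a)) y, mem_left _ y⟩) x

variable {T}

theorem IsDualPair.symm {φ ψ : 𝒜 →+* (H →L[ℂ] H)} (h : T.IsDualPair φ ψ) : T.IsDualPair ψ φ where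
  mem_left := h.mem_right
  mem_right := h.mem_left
  sub_mem a x := by
    rw [← neg_sub]
    exact T.D.domain.neg_mem (h.sub_mem a x)
  inner_left := h.inner_right
  inner_right := h.inner_left

variable (T)

/-- By unitarity `σ(σ(a)*) = a*`, so `D ψ(σ(a)*) y = a* D y`, which is the first adjunction. The
second follows for `x` in the domain by moving `D` across the inner product twice, and then for all
`x` by density. -/
theorem isDualPair_rep_twistedRep (hD : T.Invertible) : T.IsDualPair T.rep (T.twistedRep hD) where
  mem_left := T.π_mem
  mem_right := T.twistedConj_mem hD
  sub_mem := T.rep_sub_twistedRep_mem hD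
  inner_left a y x := by
    have h : T.D ⟨T.twistedRep hD (star (σ a)) y, T.twistedConj_mem hD _ y⟩
        = T.π (star a) (T.D y) := by
      have := T.D_twistedConj hD (star (σ a)) y
      rwa [T.unitarity, AlgEquiv.symm_apply_apply] at this
    rw [h, inner_π_left]
    rfl
  inner_right a y x := by
    have h : (fun x => inner ℂ (T.D y) (T.twistedRep hD a x))
        = fun x => inner ℂ (T.D ⟨T.rep (star (σ a)) y, T.π_mem _ y⟩) x := by
      refine Continuous.ext_on T.selfAdjoint.dense_domain (by fun_prop) (by fun_prop)
        fun x hx => ?_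
      have h₁ := T.inner_D_left y ⟨_, T.twistedConj_mem hD a ⟨x, hx⟩⟩
      have h₂ := T.inner_D_left ⟨_, T.π_mem (star (σ a)) y⟩ ⟨x, hx⟩
      rw [D_twistedConj] at h₁
      rw [inner_π_left] at h₂
      exact h₁.trans h₂.symm
    exact congrFun h x

/-- The pairing `⟨D y, x⟩` on `Hⁿ`. -/
def dualPairing {n : ℕ} (y : Fin n → T.D.domain) (x : Fin n → H) : ℂ :=
  ∑ i, inner ℂ (T.D (y i)) (x i)

/-- The action of a matrix on `(Dom D)ⁿ`. -/
def rectOpDomain {n : ℕ} {φ : 𝒜 →+* (H →L[ℂ] H)}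
    (hφ : ∀ a (y : T.D.domain), φ a y ∈ T.D.domain) (M : Matrix (Fin n) (Fin n) 𝒜)
    (y : Fin n → T.D.domain) : Fin n → T.D.domain :=
  fun i => ∑ j, ⟨φ (M i j) (y j), hφ _ _⟩

variable {T} in
theorem coe_rectOpDomain {n : ℕ} {φ : 𝒜 →+* (H →L[ℂ] H)}
    (hφ : ∀ a (y : T.D.domain), φ a y ∈ T.D.domain) (M : Matrix (Fin n) (Fin n) 𝒜)
    (y : Fin n → T.D.domain) (i : Fin n) :
    (T.rectOpDomain hφ M y i : H) = rectOp (M.map φ) (fun j => (y j : H)) i := by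
  simp [rectOpDomain, rectOp_apply]

theorem D_sum {n : ℕ} (y : Fin n → T.D.domain) : T.D (∑ i, y i) = ∑ i, T.D (y i) :=
  map_sum T.D.toFun y _

variable {T} in
theorem IsDualPair.dualPairing_rectOp {φ ψ : 𝒜 →+* (H →L[ℂ] H)} (h : T.IsDualPair φ ψ) {n : ℕ}
    (M : Matrix (Fin n) (Fin n) 𝒜) (y : Fin n → T.D.domain) (x : Fin n → H) :
    T.dualPairing y (rectOp (M.map ψ) x)
      = T.dualPairing (T.rectOpDomain h.mem_left (M.map σ).conjTranspose y) x := by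
  simp only [dualPairing, rectOp_apply, rectOpDomain, inner_sum, D_sum, sum_inner,
    Matrix.map_apply, h.inner_right, Matrix.conjTranspose_apply]
  exact Finset.sum_comm

/-- As `D` is odd, `D y` has sign `s` and is an admissible test vector; pairing with it gives `∑ ‖D
yᵢ‖² = 0`. -/
theorem eq_zero_of_dualPairing_eq_zero (hD : T.Invertible) {s : ℤˣ} {n : ℕ}
    {y : Fin n → T.D.domain} (hy : (fun i => (y i : H)) ∈ T.gradedPart (-s) n)
    (h : ∀ x ∈ T.gradedPart s n, T.dualPairing y x = 0) (i : Fin n) : (y i : H) = 0 := by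
  have hmem : (fun i => T.D (y i)) ∈ T.gradedPart s n := by
    intro i
    have h₁ := T.D_γ (y i)
    have h₂ : (⟨T.γ (y i), T.γ_mem (y i)⟩ : T.D.domain) = -((s : ℤ) • y i) := by
      refine Subtype.ext ?_
      simpa using hy i
    rw [h₂, LinearPMap.map_neg, neg_inj] at h₁
    rw [← h₁]
    exact map_zsmul T.D.toFun _ _
  have h₀ := h _ hmem
  rw [dualPairing] at h₀
  simp only [inner_self_eq_norm_sq_to_K] at h₀
  have h₁ : ∑ i, ‖T.D (y i)‖ ^ 2 = 0 := by
    rw [← Complex.ofReal_eq_zero]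
    simpa using h₀
  rw [Finset.sum_eq_zero_iff_of_nonneg fun _ _ => by positivity] at h₁
  have h₂ : T.D (y i) = 0 := by simpa using h₁ i (Finset.mem_univ i)
  rw [← T.Dinv_apply_D hD, h₂, map_zero]

variable {φ ψ : 𝒜 →+* (H →L[ℂ] H)} (hφ : T.IsEven φ) (hψ : T.IsEven ψ)

/-- The kernel of the operator attached to `σ(e)*` embeds into the dual of the cokernel of the
operator attached to `e`, with the opposite sign. -/
theorem finrank_ker_transfer_le (hD : T.Invertible) (h : T.IsDualPair φ ψ)
    (hφψ : ∀ a, (φ a - ψ a).IsApproximable) (s : ℤˣ) {n : ℕ} {M N : Matrix (Fin n) (Fin n) 𝒜}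
    (hM : M * M = M) (hN : N * N = N) (hMN : N = (M.map σ).conjTranspose) :
    Module.finrank ℂ (T.transfer (-s) φ hψ ⟨n, N, hN⟩ ⟨n, N, hN⟩ hφ 1).toLinearMap.ker
      ≤ Module.finrank ℂ (T.gradedRange s ψ ⟨n, M, hM⟩ ⧸
        (T.transfer s φ hψ ⟨n, M, hM⟩ ⟨n, M, hM⟩ hφ 1).toLinearMap.range) := by
  have := T.completeSpace_gradedRange hφ
  have := T.completeSpace_gradedRange hψ
  have := (T.transfer_isEssInverse hφ hψ hφψ (-s) ⟨n, N, hN⟩).isFredholm.finiteDimensional_ker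
  have := (T.transfer_isEssInverse hφ hψ hφψ s ⟨n, M, hM⟩).isFredholm.finiteDimensional_coker
  set u' := (T.transfer (-s) φ hψ ⟨n, N, hN⟩ ⟨n, N, hN⟩ hφ 1).toLinearMap
  have hgr : ∀ y : u'.ker, (y.1.1 : Fin n → H) ∈ T.gradedPart (-s) n := fun y =>
    ((T.mem_gradedRange hφ).1 y.1.2).1
  have hfix : ∀ y : u'.ker, rectOp (N.map φ) (y.1.1 : Fin n → H) = y.1.1 := fun y =>
    ((T.mem_gradedRange hφ).1 y.1.2).2
  have hker : ∀ y : u'.ker, rectOp (N.map ψ) (y.1.1 : Fin n → H) = 0 := fun y => by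
    have := congrArg Subtype.val y.2
    have h' := T.coe_transfer hφ hψ (-s) ⟨n, N, hN⟩ ⟨n, N, hN⟩ 1 y.1
    rw [mul_one] at h'
    exact h'.symm.trans this
  -- A kernel vector satisfies `y = φ(N) y - ψ(N) y`, and the difference of the representations maps
  -- into the domain of `D`.
  have hdom : ∀ (y : u'.ker) (i : Fin n), (y.1.1 : Fin n → H) i ∈ T.D.domain := fun y i => by
    have : (y.1.1 : Fin n → H) i = ∑ j, (φ (N i j) ((y.1.1 : Fin n → H) j)
        - ψ (N i j) ((y.1.1 : Fin n → H) j)) := by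
      rw [Finset.sum_sub_distrib]
      have h₁ := congrFun (hfix y) i
      have h₂ := congrFun (hker y) i
      rw [rectOp_apply] at h₁ h₂
      simp only [Matrix.map_apply] at h₁ h₂
      rw [h₁, h₂]
      simp
    rw [this]
    exact T.D.domain.sum_mem fun j _ => h.sub_mem _ _
  let Y : u'.ker → Fin n → T.D.domain := fun y i => ⟨y.1.1 i, hdom y i⟩
  have hYφ : ∀ y, T.rectOpDomain h.mem_left N (Y y) = Y y := fun y => by
    ext i
    rw [coe_rectOpDomain]
    exact congrFun (hfix y) i
  have hYψ : ∀ y, T.rectOpDomain h.mem_right N (Y y) = 0 := fun y => by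
    ext i
    rw [coe_rectOpDomain]
    exact congrFun (hker y) i
  have hpφ : ∀ y x, T.dualPairing (Y y) (rectOp (M.map ψ) x) = T.dualPairing (Y y) x :=
    fun y x => by rw [h.dualPairing_rectOp, ← hMN, hYφ]
  have hpψ : ∀ y x, T.dualPairing (Y y) (rectOp (M.map φ) x) = 0 := fun y x => by
    rw [h.symm.dualPairing_rectOp, ← hMN, hYψ]
    simp [dualPairing]
  let Φ : u'.ker →ₗ⋆[ℂ] Module.Dual ℂ (T.gradedRange s ψ ⟨n, M, hM⟩) :=
    { toFun := fun y =>
        { toFun := fun x => T.dualPairing (Y y) x.1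
          map_add' := fun a b => by
            simp [dualPairing, Finset.sum_add_distrib]
          map_smul' := fun c a => by
            simp [dualPairing, Finset.mul_sum] }
      map_add' := fun a b => by
        ext x
        have : Y (a + b) = Y a + Y b := rfl
        simp [this, dualPairing, LinearPMap.map_add, Finset.sum_add_distrib]
      map_smul' := fun c a => by
        ext x
        have : Y (c • a) = c • Y a := rfl
        simp only [this, dualPairing, Pi.smul_apply, LinearPMap.map_smul, inner_smul_left,
          LinearMap.coe_mk, AddHom.coe_mk, LinearMap.smul_apply, smul_eq_mul, Finset.mul_sum] }
  refine finrank_ker_le_finrank_coker _ u' Φ (fun y x => ?_) fun y hy => ?_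
  · have h₁ : rectOp (M.map φ) (x.1 : Fin n → H) = x.1 := ((T.mem_gradedRange hφ).1 x.2).2
    have h₂ := T.coe_transfer hφ hψ s ⟨n, M, hM⟩ ⟨n, M, hM⟩ 1 x
    rw [mul_one] at h₂
    change T.dualPairing (Y y) (T.transfer s φ hψ ⟨n, M, hM⟩ ⟨n, M, hM⟩ hφ 1 x).1 = 0
    rw [h₂]
    refine (hpφ y _).trans ?_
    rw [← h₁]
    exact hpψ y _
  · refine Subtype.ext (Subtype.ext (funext fun i => ?_))
    -- Pairing with an arbitrary `x` of sign `s` is the same as pairing with `ψ(M) x`, which lies in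
    -- the space on which `Φ y` vanishes.
    refine T.eq_zero_of_dualPairing_eq_zero hD (y := Y y) (hgr y) (fun x hx => ?_) i
    rw [← hpφ]
    exact congrArg (fun f => f ⟨rectOp (M.map ψ) x, x, hx, rfl⟩) hy

/-- The chain `a₁ + c₁ ≤ b₂ + d₂ = a₂ + c₂ ≤ b₁ + d₁ = a₁ + c₁` closes up, so all four inequalities
are equalities. -/
theorem sub_add_sub_eq_zero_of_le {a₁ b₁ c₁ d₁ a₂ b₂ c₂ d₂ : ℕ}
    (h₁ : ((a₁ : ℤ) - b₁) + (c₁ - d₁) = 0) (h₂ : ((a₂ : ℤ) - b₂) + (c₂ - d₂) = 0)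
    (k₁ : a₁ ≤ b₂) (k₂ : c₁ ≤ d₂) (k₃ : a₂ ≤ b₁) (k₄ : c₂ ≤ d₁) :
    ((a₁ : ℤ) - b₁) + (a₂ - b₂) = 0 := by
  lia

/-- The index with one sign of `σ(e)*` is minus the index with the other sign of `e`. -/
theorem indexOp_index_add_index (hD : T.Invertible) (s : ℤˣ) {n : ℕ}
    {M N : Matrix (Fin n) (Fin n) 𝒜} (hM : M * M = M) (hN : N * N = N)
    (hMN : N = (M.map σ).conjTranspose) :
    (T.indexOp hD (-s) ⟨n, N, hN⟩).toLinearMap.index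
      + (T.indexOp hD s ⟨n, M, hM⟩).toLinearMap.index = 0 := by
  -- Unitarity makes `e ↦ σ(e)*` an involution, so the roles of `M` and `N` can be exchanged.
  have hNM : M = (N.map σ).conjTranspose := by
    ext i j
    simp [hMN, T.unitarity]
  have hφ := T.rep_isEven
  have hψ := T.twistedRep_isEven hD
  have hd := T.isDualPair_rep_twistedRep hD
  have ha := T.rep_sub_twistedRep_isApproximable hD
  have ha' : ∀ a, (T.twistedRep hD a - T.rep a).IsApproximable := fun a => by
    rw [← neg_sub]
    exact (ha a).neg
  have := T.completeSpace_gradedRange hφ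
  have := T.completeSpace_gradedRange hψ
  have i₁ := (T.transfer_isEssInverse hφ hψ ha (-s) ⟨n, N, hN⟩).index_add_index
  have i₂ := (T.transfer_isEssInverse hφ hψ ha s ⟨n, M, hM⟩).index_add_index
  have k₁ := T.finrank_ker_transfer_le hφ hψ hD hd ha s hM hN hMN
  have k₂ := T.finrank_ker_transfer_le hψ hφ hD hd.symm ha' s hM hN hMN
  have k₃ := T.finrank_ker_transfer_le hφ hψ hD hd ha (-s) hN hM hNM
  have k₄ := T.finrank_ker_transfer_le hψ hφ hD hd.symm ha' (-s) hN hM hNM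
  rw [neg_neg] at k₃ k₄
  have key : (T.transfer (-s) T.rep hψ ⟨n, N, hN⟩ ⟨n, N, hN⟩ hφ 1).toLinearMap.index
      + (T.transfer s T.rep hψ ⟨n, M, hM⟩ ⟨n, M, hM⟩ hφ 1).toLinearMap.index = 0 := by
    simp only [LinearMap.index_eq_finrank_sub] at i₁ i₂ ⊢
    exact sub_add_sub_eq_zero_of_le i₁ i₂ k₁ k₂ k₃ k₄
  exact (congrArg₂ (· + ·) (T.indexOp_index hD (-s) ⟨n, N, hN⟩)
    (T.indexOp_index hD s ⟨n, M, hM⟩)).trans key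

end GradedTwistedSpectralTriple

end

/-! ### The index maps on `K₀(A)`. -/

noncomputable section

section IndexMap

variable {A : Type*} [NormedRing A] [NormedAlgebra ℂ A] [CompleteSpace A] [StarRing A]
  [StarModule ℂ A] {τ : IsometricOneParameterGroup A} {𝒪 : StarSubalgebra ℂ A} {σ : 𝒪 ≃ₐ[ℂ] 𝒪}
  {H : Type*} [NormedAddCommGroup H] [InnerProductSpace ℂ H] [CompleteSpace H]
  (T : GradedTwistedSpectralTriple H 𝒪 σ) (hD : T.Invertible)

/-- The index is an invariant of equivalence over `A`. -/
theorem OnePG.indexOp_index_eq (h : OnePG τ 𝒪 σ) (s : ℤˣ) {e f : IdemMatrix 𝒪}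
    (hef : (e.map 𝒪.subtype.toRingHom).Equivalent (f.map 𝒪.subtype.toRingHom)) :
    (T.indexOp hD s e).toLinearMap.index = (T.indexOp hD s f).toLinearMap.index :=
  T.indexOp_index_eq_of_equivalent hD s (equivalent_of_map_equivalent h.dense h.stable hef)

/-- An idempotent over `A` is assigned the index of a chosen equivalent idempotent over `𝒪`. The
choice is immaterial, because equivalence over `A` between idempotents over `𝒪` already holds over
`𝒪`. -/
theorem OnePG.exists_isIndexMap (h : OnePG τ 𝒪 σ) (s : ℤˣ) :
    ∃ I : K0 A →+ ℤ, IsIndexMap T hD s I := by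
  choose b hb using exists_equivalent_map h.dense h.stable
  refine ⟨K0.lift (fun e => (T.indexOp hD s (b e)).toLinearMap.index) (fun e f hef => ?_)
    (fun e f => ?_), fun e => ⟨T.indexOp_isFredholm hD s e, ?_⟩⟩
  · exact h.indexOp_index_eq T hD s ((hb e).trans (hef.trans (hb f).symm))
  · rw [← T.indexOp_index_blockSum]
    refine h.indexOp_index_eq T hD s ((hb _).trans ?_)
    rw [IdemMatrix.map_blockSum]
    exact ((hb e).blockSum (hb f)).symm
  · rw [K0.lift_cls]
    exact h.indexOp_index_eq T hD s (hb _)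

theorem OnePG.isIndexMap_unique (h : OnePG τ 𝒪 σ) {s : ℤˣ} {I J : K0 A →+ ℤ}
    (hI : IsIndexMap T hD s I) (hJ : IsIndexMap T hD s J) : I = J := by
  refine K0.hom_ext fun e => ?_
  obtain ⟨b, hb⟩ := exists_equivalent_map h.dense h.stable e
  rw [← K0.cls_eq_of_equivalent hb, (hI b).2, (hJ b).2]

theorem OnePG.existsUnique_isIndexMap (h : OnePG τ 𝒪 σ) (s : ℤˣ) :
    ∃! I : K0 A →+ ℤ, IsIndexMap T hD s I := by
  obtain ⟨I, hI⟩ := h.exists_isIndexMap T hD s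
  exact ⟨I, hI, fun J hJ => h.isIndexMap_unique T hD hJ hI⟩

/-- The two index maps are opposite to each other on the classes of self-adjoint projections. -/
theorem OnePG.isIndexMap_eq_neg [NormedStarGroup A] (hA : K0GeneratedByProjections A)
    (h : OnePG τ 𝒪 σ) {s : ℤˣ} {I J : K0 A →+ ℤ} (hI : IsIndexMap T hD s I)
    (hJ : IsIndexMap T hD (-s) J) : I = -J := by
  refine AddMonoidHom.eq_of_eqOn_dense hA ?_
  rintro _ ⟨p, hp, rfl⟩
  obtain ⟨e, he⟩ := exists_equivalent_map h.dense h.stable p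
  -- The representative `e` over `𝒪` need not be self-adjoint, but `[σ(e)*] = [e*] = [p*] = [p]`.
  have hcls : K0.cls ((e.map (σ : 𝒪 →+* 𝒪)).adjoint.map 𝒪.subtype.toRingHom) = K0.cls p := by
    rw [h.cls_adjoint_map_eq]
    refine K0.cls_eq_of_equivalent (he.adjoint.trans ?_)
    have : p.adjoint = p := by
      obtain ⟨n, M, hM⟩ := p
      simpa [IdemMatrix.adjoint] using hp
    rw [this]
    exact .refl p
  have h₁ := T.indexOp_index_add_index hD s e.idem (e.map (σ : 𝒪 →+* 𝒪)).adjoint.idem rfl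
  have h₂ : J (K0.cls p) + I (K0.cls p) = 0 := by
    rw [← K0.cls_eq_of_equivalent he, (hI e).2, K0.cls_eq_of_equivalent he, ← hcls, (hJ _).2]
    exact h₁
  rw [AddMonoidHom.neg_apply]
  lia

end IndexMap

end

theorem mainTheorem4
    {A : Type*} [NormedRing A] [NormedAlgebra ℂ A] [CompleteSpace A] [StarRing A]
    [NormedStarGroup A] [StarModule ℂ A] (hA : K0GeneratedByProjections A)
    (τ : IsometricOneParameterGroup A) (𝒪 : StarSubalgebra ℂ A) (σ : 𝒪 ≃ₐ[ℂ] 𝒪)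
    (h1PG : OnePG τ 𝒪 σ)
    {H : Type*} [NormedAddCommGroup H] [InnerProductSpace ℂ H] [CompleteSpace H]
    (T : GradedTwistedSpectralTriple H 𝒪 σ) (hD : T.Invertible) :
    (∃! Iplus : K0 A →+ ℤ, IsIndexMap T hD 1 Iplus) ∧
    (∃! Iminus : K0 A →+ ℤ, IsIndexMap T hD (-1) Iminus) ∧
    ∀ Iplus Iminus : K0 A →+ ℤ, IsIndexMap T hD 1 Iplus → IsIndexMap T hD (-1) Iminus →
      Iplus = -Iminus ∧ ∃ J : K0 A →+ ℤ, Iplus.prod Iminus = J.prod (-J) := by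
  refine ⟨h1PG.existsUnique_isIndexMap T hD 1, h1PG.existsUnique_isIndexMap T hD (-1),
    fun Iplus Iminus hplus hminus => ?_⟩
  have h := h1PG.isIndexMap_eq_neg T hD hA hplus hminus
  exact ⟨h, Iplus, by rw [h, neg_neg]⟩
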